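/- Let $p>1$ and $M\in\mathbb R$, and consider in dimension $N=1$ the radial equation $$-u''=|u|^{p-1}u+M|u'|^{\frac{2p}{p+1}}\qquad (r>0).\tag{E}$$ A *ground state* is a positive function $u\in C^2([0,\infty))$ with $u'(0)=0$ which satisfies (E) on $(0,\infty)$. A *positive singular solution* is a positive function $u\in C^2((0,\infty))$ which satisfies (E) on $(0,\infty)$ and tends to $\infty$ as $r\to0$. Set $$\mu^*(1)=(p+1)\left(\frac{p+1}{2p}\right)^{\frac p{p+1}},$$ and consider the positive roots $X$ of $$X^{p-1}+M\left(\frac2{p-1}\right)^{\frac{2p}{p+1}}X^{\frac{p-1}{p+1}}+\frac{2(p+1)}{(p-1)^2}=0 .\tag{R}$$ Let $X_{2,M}$ be the greatest positive root of (R) and, when there are exactly two positive roots, let $X_{1,M}$ be the smaller one. For these roots put $U_{j,M}(r)=X_{j,M}\,r^{-\frac2{p-1}}$ and $P_{j,M}=\left(X_{j,M},\frac2{p-1}X_{j,M}\right)$. **Theorem.** 1. There exists a ground state if and only if $M\le-\mu^*(1)$. In that case (R) has a greatest positive root, and every ground state $u$ satisfies $u(r)\sim U_{2,M}(r)$ as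 $r\to\infty$. 2. If $M<-\mu^*(1)$, then (R) has exactly two positive roots $X_{1,M}<X_{2,M}$, and there exists a positive singular solution $u$ such that $u(r)\sim U_{1,M}(r)$ as $r\to0$ and $u(r)\sim U_{2,M}(r)$ as $r\to\infty$. Moreover, with $r=e^t$, its trajectory $x(t)=r^{\frac2{p-1}}u(r)$, $y(t)=-r^{\frac{p+1}{p-1}}u'(r)$ stays in $\{x>0,\ y>0\}$ and is a heteroclinic orbit of the system $$x_t=\frac2{p-1}x-y,\qquad y_t=\frac{p+1}{p-1}\,y+|x|^{p-1}x+M|y|^{\frac{2p}{p+1}},$$ that is, a solution on $\mathbb R$ which connects the equilibrium $P_{1,M}$ (as $t\to-\infty$) to the different equilibrium $P_{2,M}$ (as $t\to\infty$). -/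

import Mathlib

open Filter Topology Asymptotics

namespace RadialGrad

/-- `u` is a `C²` solution on `(0, ∞)` of the radial equation
`-u'' - ((N-1)/r) u' = |u|^(p-1) u + M |u'|^(2p/(p+1))`.
Only the values of `u` on `(0, ∞)` matter. -/
structure IsRadialSolution (N : ℕ) (p M : ℝ) (u : ℝ → ℝ) : Prop where
  contDiffOn : ContDiffOn ℝ 2 u (Set.Ioi 0)
  equation : ∀ r : ℝ, 0 < r →
    -deriv (deriv u) r - ((N : ℝ) - 1) / r * deriv u r
      = |u r| ^ (p - 1) * u r + M * |deriv u r| ^ (2 * p / (p + 1))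

/-- A (radial) ground state: a positive solution that is `C²` on the closed half-line `[0, ∞)`
and satisfies `u'(0) = 0`, so that `x ↦ u(|x|)` is a `C²` function on the whole of `ℝ^N`. -/
structure IsGroundState (N : ℕ) (p M : ℝ) (u : ℝ → ℝ) : Prop where
  isRadialSolution : IsRadialSolution N p M u
  contDiffOn_Ici : ContDiffOn ℝ 2 u (Set.Ici 0)
  derivWithin_zero : derivWithin u (Set.Ici 0) 0 = 0
  pos : ∀ r : ℝ, 0 ≤ r → 0 < u r

/-- A positive solution on `(0, ∞)` that blows up at the origin. -/
structure IsPositiveSingularSolution (N : ℕ) (p M : ℝ) (u : ℝ → ℝ) : Prop where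
  isRadialSolution : IsRadialSolution N p M u
  pos : ∀ r : ℝ, 0 < r → 0 < u r
  singular : Tendsto u (𝓝[>] 0) atTop

/-- `K = ((N-2)p - N)/(p-1)`. -/
noncomputable def K (N : ℕ) (p : ℝ) : ℝ := (((N : ℝ) - 2) * p - N) / (p - 1)

/-- `μ*(N) = (p+1) ((N - (N-2)p)/(2p))^(p/(p+1))`. -/
noncomputable def muStar (N : ℕ) (p : ℝ) : ℝ :=
  (p + 1) * (((N : ℝ) - ((N : ℝ) - 2) * p) / (2 * p)) ^ (p / (p + 1))

/-- The positive roots `X` of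
`X^(p-1) + M (2/(p-1))^(2p/(p+1)) X^((p-1)/(p+1)) - 2K/(p-1) = 0`. -/
def positiveRoots (N : ℕ) (p M : ℝ) : Set ℝ :=
  {X | 0 < X ∧ X ^ (p - 1)
    + M * (2 / (p - 1)) ^ (2 * p / (p + 1)) * X ^ ((p - 1) / (p + 1)) - 2 * K N p / (p - 1) = 0}

/-- The self-similar function `U(r) = X r^(-2/(p-1))`. -/
noncomputable def selfSimilar (p X : ℝ) (r : ℝ) : ℝ := X * r ^ (-(2 / (p - 1)))

/-- The point `P = (X, 2X/(p-1))` of the phase plane. -/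
noncomputable def equilibrium (p X : ℝ) : ℝ × ℝ := (X, 2 / (p - 1) * X)

/-- The vector field `H` of the autonomous planar system
`x' = 2x/(p-1) - y`, `y' = -K y + |x|^(p-1) x + M |y|^(2p/(p+1))`. -/
noncomputable def vectorField (N : ℕ) (p M : ℝ) (z : ℝ × ℝ) : ℝ × ℝ :=
  (2 / (p - 1) * z.1 - z.2,
    -K N p * z.2 + |z.1| ^ (p - 1) * z.1 + M * |z.2| ^ (2 * p / (p + 1)))

/-- The phase-plane trajectory of `u`: `x(t) = r^(2/(p-1)) u(r)`,
`y(t) = -r^((p+1)/(p-1)) u'(r)` with `r = exp t`. -/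
noncomputable def trajectory (p : ℝ) (u : ℝ → ℝ) (t : ℝ) : ℝ × ℝ :=
  (Real.exp t ^ (2 / (p - 1)) * u (Real.exp t),
    -(Real.exp t ^ ((p + 1) / (p - 1)) * deriv u (Real.exp t)))

/-- `z` is an orbit of the planar vector field `H`, defined on all of `ℝ`, that connects the
equilibrium `P` (as `t → -∞`) to a different equilibrium `Q` (as `t → ∞`). -/
structure IsHeteroclinicOrbit (H : ℝ × ℝ → ℝ × ℝ) (z : ℝ → ℝ × ℝ) (P Q : ℝ × ℝ) : Prop where
  hasDerivAt : ∀ t : ℝ, HasDerivAt z (H (z t)) t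
  equilibrium_left : H P = 0
  equilibrium_right : H Q = 0
  ne : P ≠ Q
  tendsto_atBot : Tendsto z atBot (𝓝 P)
  tendsto_atTop : Tendsto z atTop (𝓝 Q)

end RadialGrad

/-! In dimension one the equation is autonomous in `r` and invariant under scaling, so its dynamics
reduce to one scalar equation. For `u > 0` put `φ = u^(-(p-1)/2)` and `k = -u' u^(-(p+1)/2)`. Then
`φ' = (p-1)/2 · k` and `k' = H(k)/φ`, where `H(k) = 1 + (p+1)/2 k² + M|k|^(2p/(p+1))`; in the time
`τ` with `dτ = dr/φ` this is `dk/dτ = H(k)`.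

A positive zero of `H` is a self-similar solution. The amplitude decreases in `k`, so the smallest
zero `k₂` gives the greatest root of (R) (`rootPolynomial_amplitude`). For `k > 0`, `H(k) = 0` means
that `-M` equals `threshold p k`, a function that decreases and then increases, with minimum
`μ*(1)`. Hence `H` has a positive zero exactly when `M ≤ -μ*(1)`, and exactly two when the
inequality is strict.

A ground state starts at `k = 0`, where `H = 1`. If `H` has a zero, `k` increases to `k₂` without
reaching it in finite time, and `φ/r → (p-1)k₂/2` gives the asymptotics (`le_first_zero`,
`exists_tendsto`). If `H` has no zero, `k` is unbounded and `√u` is forced below zero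
(`false_of_profile_pos`). Conversely, integrating the scalar equation and undoing the time change
produces ground states.

When there are two zeros `k₂ < k₁`, `H < 0` between them, and the scalar orbit descending from `k₁`
to `k₂` is the singular solution (`exists_connecting_phase`). -/

namespace RadialGrad

/-! ### Scalar autonomous equations -/

/-- The scalar equation `T' = 1 / f(T)`, `T(0) = 0` has a global solution when `f` is continuous
and bounded below by a positive constant. -/
theorem exists_solution_inv {f : ℝ → ℝ} (hf : Continuous f) {c : ℝ} (hc : 0 < c)
    (hcf : ∀ x, c ≤ f x) :
    ∃ T : ℝ → ℝ, T 0 = 0 ∧ (∀ r, HasDerivAt T (1 / f (T r)) r) ∧ StrictMono T ∧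
      Tendsto T atTop atTop ∧ Tendsto T atBot atBot := by
  -- Separation of variables: `R` is the inverse of the solution. The bound `f ≥ c` gives at least
  -- linear growth, so `R` is onto and the solution is global.
  set R : ℝ → ℝ := fun x => ∫ y in (0 : ℝ)..x, f y with hR
  have hR0 : R 0 = 0 := by simp [hR]
  have hd : ∀ x, HasDerivAt R (f x) x := fun x =>
    (hf.integral_hasStrictDerivAt 0 x).hasDerivAt
  have hcont : Continuous R := continuous_iff_continuousAt.2 fun x => (hd x).continuousAt
  have hmono : StrictMono R := strictMono_of_deriv_pos fun x => by
    rw [(hd x).deriv]; exact hc.trans_le (hcf x)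
  have hmono2 : Monotone fun x => R x - c * x := by
    refine monotone_of_deriv_nonneg (fun x => ?_) fun x => ?_
    · exact ((hd x).sub ((hasDerivAt_id x).const_mul c)).differentiableAt
    · have := ((hd x).sub ((hasDerivAt_id x).const_mul c)).deriv
      simp only [mul_one] at this
      erw [this]
      linarith [hcf x]
  have htop : Tendsto R atTop atTop := by
    refine tendsto_atTop_mono' atTop ?_ (tendsto_id.const_mul_atTop hc)
    filter_upwards [eventually_ge_atTop 0] with x hx
    have := hmono2 hx
    simp [hR0] at this
    simpa using this
  have hbot : Tendsto R atBot atBot := by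
    refine tendsto_atBot_mono' atBot ?_ (tendsto_id.const_mul_atBot hc)
    filter_upwards [eventually_le_atBot 0] with x hx
    have := hmono2 hx
    simp [hR0] at this
    simpa using this
  have hsurj : Function.Surjective R := hcont.surjective htop hbot
  let e : ℝ ≃o ℝ := StrictMono.orderIsoOfSurjective R hmono hsurj
  have he : ∀ x, e (e.symm x) = x := fun x => e.apply_symm_apply x
  refine ⟨e.symm, ?_, fun r => ?_, e.symm.strictMono, e.symm.tendsto_atTop, e.symm.tendsto_atBot⟩
  · rw [e.symm_apply_eq]; exact hR0.symm
  · rw [one_div]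
    exact HasDerivAt.of_local_left_inverse e.symm.continuous.continuousAt (hd _)
      (hc.trans_le (hcf _)).ne' (Eventually.of_forall he)

/-- An autonomous scalar equation whose right-hand side is positive on `(a, b)` and vanishes at
most linearly at the endpoints has a global solution connecting `a` to `b`. -/
theorem exists_connecting_solution {f : ℝ → ℝ} {a b L c : ℝ} (hc : c ∈ Set.Ioo a b)
    (hf : ContinuousOn f (Set.Ioo a b)) (hpos : ∀ x ∈ Set.Ioo a b, 0 < f x)
    (hL : 0 < L)
    (ha : ∀ x ∈ Set.Ioo a b, f x ≤ L * (x - a)) (hb : ∀ x ∈ Set.Ioo a b, f x ≤ L * (b - x)) :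
    ∃ k : ℝ → ℝ, k 0 = c ∧ (∀ t, k t ∈ Set.Ioo a b) ∧ (∀ t, HasDerivAt k (f (k t)) t) ∧
      Tendsto k atBot (𝓝 a) ∧ Tendsto k atTop (𝓝 b) := by
  have hab : 0 < b - a := by linarith [hc.1, hc.2]
  obtain ⟨θ₀, hθ₀⟩ : (c - a) / (b - a) ∈ Set.range Real.sigmoid := by
    rw [Real.range_sigmoid]
    exact ⟨div_pos (by linarith [hc.1]) hab, (div_lt_one hab).2 (by linarith [hc.2])⟩
  -- The logistic curve is a model connecting solution, shifted so that `S 0 = c`. The solution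
  -- sought is a reparametrization `S ∘ T`.
  set S : ℝ → ℝ := fun θ => a + (b - a) * Real.sigmoid (θ + θ₀) with hS
  have hSmem : ∀ θ, S θ ∈ Set.Ioo a b := fun θ => by
    have h1 := Real.sigmoid_pos (θ + θ₀)
    have h2 := Real.sigmoid_lt_one (θ + θ₀)
    constructor <;> simp only [hS] <;> nlinarith
  have hSd : ∀ θ, HasDerivAt S
      ((b - a) * (Real.sigmoid (θ + θ₀) * (1 - Real.sigmoid (θ + θ₀)))) θ := fun θ => by
    have := ((Real.hasDerivAt_sigmoid (θ + θ₀)).comp_add_const θ θ₀).const_mul (b - a)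
    exact this.const_add a
  have hScont : Continuous S := continuous_iff_continuousAt.2 fun x => (hSd x).continuousAt
  have hsig : Continuous fun θ => Real.sigmoid (θ + θ₀) := by fun_prop
  have hfS : Continuous fun θ => f (S θ) := hf.comp_continuous hScont hSmem
  obtain ⟨T, hT0, hTd, -, hTtop, hTbot⟩ := exists_solution_inv
    (f := fun θ => (b - a) * (Real.sigmoid (θ + θ₀) * (1 - Real.sigmoid (θ + θ₀))) / f (S θ))
    (by
      refine Continuous.div ?_ hfS fun θ => (hpos _ (hSmem θ)).ne'
      exact continuous_const.mul (hsig.mul (continuous_const.sub hsig)))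
    -- With `s` the sigmoid, `f ≤ L (b-a) min(s, 1-s)`, so the quotient is at least `max(s, 1-s)/L ≥
    -- 1/(2L)`.
    (c := 1 / (2 * L)) (by positivity) (fun θ => by
      have h1 := Real.sigmoid_pos (θ + θ₀)
      have h2 := Real.sigmoid_lt_one (θ + θ₀)
      have h3 := ha _ (hSmem θ)
      have h4 := hb _ (hSmem θ)
      rw [div_le_div_iff₀ (by positivity) (hpos _ (hSmem θ))]
      have h5 : S θ - a = (b - a) * Real.sigmoid (θ + θ₀) := by simp [hS]
      have h6 : b - S θ = (b - a) * (1 - Real.sigmoid (θ + θ₀)) := by simp only [hS]; ring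
      rw [h5] at h3
      rw [h6] at h4
      set s := Real.sigmoid (θ + θ₀)
      have h7 : 0 < L * (b - a) := by positivity
      rcases le_total s (1 / 2) with h | h
      · nlinarith [mul_nonneg (mul_nonneg h7.le h1.le) (sub_nonneg.2 h)]
      · nlinarith [mul_nonneg (mul_nonneg h7.le (sub_pos.2 h2).le) (sub_nonneg.2 h)])
  refine ⟨fun t => S (T t), ?_, fun t => hSmem _, fun t => ?_, ?_, ?_⟩
  · simp only [hT0, hS, zero_add, hθ₀]
    field_simp
    ring
  · have h := (hSd (T t)).comp t (hTd t)
    refine h.congr_deriv ?_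
    have h1 := Real.sigmoid_pos (T t + θ₀)
    have h2 := sub_pos.2 (Real.sigmoid_lt_one (T t + θ₀))
    field_simp
  · have : Tendsto (fun t => S (T t)) atBot (𝓝 (a + (b - a) * 0)) :=
      ((Real.tendsto_sigmoid_atBot.comp
        (tendsto_atBot_add_const_right atBot θ₀ hTbot)).const_mul (b - a)).const_add a
    simpa using this
  · have : Tendsto (fun t => S (T t)) atTop (𝓝 (a + (b - a) * 1)) :=
      ((Real.tendsto_sigmoid_atTop.comp
        (tendsto_atTop_add_const_right atTop θ₀ hTtop)).const_mul (b - a)).const_add a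
    simpa using this

/-- If `f'` tends to `c` at infinity, so does `f(r) / r`. -/
theorem tendsto_div_id_of_tendsto_deriv {f f' : ℝ → ℝ} {c : ℝ}
    (hf : ∀ᶠ r in atTop, HasDerivAt f (f' r) r) (hf' : Tendsto f' atTop (𝓝 c)) :
    Tendsto (fun r => f r / r) atTop (𝓝 c) := by
  have key : (fun r => f r - c * r) =o[atTop] (fun r : ℝ => r) := by
    rw [isLittleO_iff]
    intro ε hε
    obtain ⟨R, hR⟩ := eventually_atTop.1 (hf.and ((Metric.tendsto_nhds.1 hf' (ε / 2)
      (by positivity))))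
    filter_upwards [eventually_ge_atTop R, eventually_ge_atTop 0,
      eventually_ge_atTop (2 * (|f R - c * R| + ε / 2 * |R|) / ε)] with r hr hr0 hr1
    have h1 := (convex_Ici R).norm_image_sub_le_of_norm_hasDerivWithin_le
      (f := fun r => f r - c * r) (f' := fun r => f' r - c * 1) (C := ε / 2)
      (fun x hx => ((hR x hx).1.sub ((hasDerivAt_id x).const_mul c)).hasDerivWithinAt)
      (fun x hx => by
        have := (hR x hx).2
        rw [Real.dist_eq] at this
        simpa using this.le) (Set.self_mem_Ici) (Set.mem_Ici.2 hr)
    rw [div_le_iff₀ hε] at hr1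
    simp only [Real.norm_eq_abs] at h1 ⊢
    rw [abs_of_nonneg hr0]
    rw [abs_of_nonneg (sub_nonneg.2 hr)] at h1
    have h2 := abs_sub_abs_le_abs_sub (f r - c * r) (f R - c * R)
    nlinarith [neg_abs_le R, abs_nonneg R]
  have h2 := (isLittleO_iff_tendsto' (by
    filter_upwards [eventually_ne_atTop 0] with r hr h using absurd h hr)).1 key
  have h3 := h2.add_const c
  rw [zero_add] at h3
  refine h3.congr' ?_
  filter_upwards [eventually_ne_atTop 0] with r hr
  field_simp
  ring

/-! ### The profile and its zeros -/

/-- The function `H(k) = 1 + (p+1)/2 k² + M |k|^(2p/(p+1))` which governs the slope variable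
`k = -u' u^(-(p+1)/2)`. -/
noncomputable def profile (p M k : ℝ) : ℝ :=
  1 + (p + 1) / 2 * k ^ 2 + M * |k| ^ (2 * p / (p + 1))

/-- The amplitude `X` of the self-similar solution whose slope variable is constantly `k`. -/
noncomputable def amplitude (p k : ℝ) : ℝ := ((p - 1) / 2 * k) ^ (-(2 / (p - 1)))

theorem profile_zero {p M : ℝ} (hp : 1 < p) : profile p M 0 = 1 := by
  have : 2 * p / (p + 1) ≠ 0 := by positivity
  simp [profile, Real.zero_rpow this]

theorem profile_abs (p M k : ℝ) : profile p M |k| = profile p M k := by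
  simp [profile]

theorem continuous_profile {p : ℝ} (M : ℝ) (hp : 1 < p) : Continuous (profile p M) := by
  have : 0 ≤ 2 * p / (p + 1) := by positivity
  unfold profile
  refine Continuous.add (by fun_prop) (continuous_const.mul ?_)
  exact continuous_abs.rpow_const fun _ => Or.inr this

/-- The value of `-M` for which `k` is a zero of the profile. -/
noncomputable def threshold (p k : ℝ) : ℝ :=
  k ^ (-(2 * p / (p + 1))) + (p + 1) / 2 * k ^ (2 / (p + 1))

/-- Taking out the power of `k` that multiplies `M` leaves `M` as an additive constant, so positive
zeros become a level set of a function of `p` and `k` alone. -/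
theorem profile_eq {p M k : ℝ} (hp : 1 < p) (hk : 0 < k) :
    profile p M k = k ^ (2 * p / (p + 1)) * (threshold p k + M) := by
  have h1 : k ^ (2 * p / (p + 1)) * k ^ (-(2 * p / (p + 1))) = 1 := by
    rw [← Real.rpow_add hk]; simp
  have h2 : k ^ (2 * p / (p + 1)) * k ^ (2 / (p + 1)) = k ^ 2 := by
    rw [← Real.rpow_add hk, ← Real.rpow_natCast]
    congr 1
    push_cast
    field_simp
  rw [profile, threshold, abs_of_pos hk]
  linear_combination -h1 - (p + 1) / 2 * h2

/-- The derivative has the sign of `k² - 2p/(p+1)`, which locates the only minimum. -/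
theorem hasDerivAt_threshold {p k : ℝ} (hp : 1 < p) (hk : 0 < k) :
    HasDerivAt (threshold p)
      (k ^ (-(2 * p / (p + 1)) - 1) * (k ^ 2 - 2 * p / (p + 1))) k := by
  have h1 := Real.hasDerivAt_rpow_const (x := k) (p := -(2 * p / (p + 1))) (Or.inl hk.ne')
  have h2 := (Real.hasDerivAt_rpow_const (x := k) (p := 2 / (p + 1))
    (Or.inl hk.ne')).const_mul ((p + 1) / 2)
  refine (h1.add h2).congr_deriv ?_
  have h3 : k ^ (-(2 * p / (p + 1)) - 1) * k ^ 2 = k ^ (2 / (p + 1) - 1) := by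
    rw [← Real.rpow_natCast, ← Real.rpow_add hk]
    congr 1
    push_cast
    field_simp
    ring
  rw [mul_sub, h3]
  field_simp
  ring

theorem continuousOn_threshold {p : ℝ} (hp : 1 < p) :
    ContinuousOn (threshold p) (Set.Ioi 0) := fun _ hk =>
  (hasDerivAt_threshold hp hk).continuousAt.continuousWithinAt

theorem strictAntiOn_threshold {p : ℝ} (hp : 1 < p) :
    StrictAntiOn (threshold p) (Set.Ioc 0 √(2 * p / (p + 1))) := by
  refine strictAntiOn_of_deriv_neg (convex_Ioc _ _)
    ((continuousOn_threshold hp).mono fun _ h => h.1) fun k hk => ?_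
  rw [interior_Ioc] at hk
  rw [(hasDerivAt_threshold hp hk.1).deriv]
  have := (Real.lt_sqrt hk.1.le).1 hk.2
  exact mul_neg_of_pos_of_neg (Real.rpow_pos_of_pos hk.1 _) (by linarith)

theorem strictMonoOn_threshold {p : ℝ} (hp : 1 < p) :
    StrictMonoOn (threshold p) (Set.Ici √(2 * p / (p + 1))) := by
  have hq : 0 < √(2 * p / (p + 1)) := by positivity
  refine strictMonoOn_of_deriv_pos (convex_Ici _)
    ((continuousOn_threshold hp).mono fun _ h => hq.trans_le h) fun k hk => ?_
  rw [interior_Ici] at hk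
  have hk0 := hq.trans hk
  rw [(hasDerivAt_threshold hp hk0).deriv]
  have := (Real.sqrt_lt' hk0).1 hk
  exact mul_pos (Real.rpow_pos_of_pos hk0 _) (by linarith)

theorem threshold_sqrt {p : ℝ} (hp : 1 < p) :
    threshold p √(2 * p / (p + 1)) = muStar 1 p := by
  have hq : 0 < √(2 * p / (p + 1)) := by positivity
  -- At `M = 0` and `k² = 2p/(p+1)` the profile is simply `p + 1`.
  have h := profile_eq (M := 0) hp hq
  have hqq : 0 < 2 * p / (p + 1) := by positivity
  have h1 : √(2 * p / (p + 1)) ^ (2 * p / (p + 1)) = (2 * p / (p + 1)) ^ (p / (p + 1)) := by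
    rw [Real.sqrt_eq_rpow, ← Real.rpow_mul hqq.le]
    congr 1
    ring
  have h2 : (((1 : ℕ) : ℝ) - (((1 : ℕ) : ℝ) - 2) * p) / (2 * p) = (2 * p / (p + 1))⁻¹ := by
    rw [inv_div]
    push_cast
    ring
  rw [profile, Real.sq_sqrt hqq.le, h1] at h
  rw [muStar, h2, Real.inv_rpow hqq.le]
  have h3 := Real.rpow_pos_of_pos hqq (p / (p + 1))
  have h4 : 1 + (p + 1) / 2 * (2 * p / (p + 1)) = p + 1 := by
    field_simp
    ring
  rw [h4] at h
  field_simp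
  linarith

theorem muStar_le_threshold {p k : ℝ} (hp : 1 < p) (hk : 0 < k) :
    muStar 1 p ≤ threshold p k := by
  have hq : 0 < √(2 * p / (p + 1)) := by positivity
  rw [← threshold_sqrt hp]
  rcases le_total k √(2 * p / (p + 1)) with h | h
  · exact (strictAntiOn_threshold hp).antitoneOn ⟨hk, h⟩ ⟨hq, le_rfl⟩ h
  · exact (strictMonoOn_threshold hp).monotoneOn Set.self_mem_Ici h h

theorem profile_pos {p M : ℝ} (hp : 1 < p) (hM : -muStar 1 p < M) (k : ℝ) :
    0 < profile p M k := by
  rw [← profile_abs]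
  rcases (abs_nonneg k).eq_or_lt with h | h
  · rw [← h, profile_zero hp]; exact one_pos
  · rw [profile_eq hp h]
    have := muStar_le_threshold hp h
    exact mul_pos (Real.rpow_pos_of_pos h _) (by linarith)

/-- The zero of the profile in `(0, √(2p/(p+1))]`. -/
theorem exists_first_zero {p M : ℝ} (hp : 1 < p) (hM : M ≤ -muStar 1 p) :
    ∃ k₂, 0 < k₂ ∧ k₂ ≤ √(2 * p / (p + 1)) ∧ profile p M k₂ = 0 ∧
      ∀ k, 0 ≤ k → k < k₂ → 0 < profile p M k := by
  have hq : 0 < √(2 * p / (p + 1)) := by positivity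
  have h1 : profile p M √(2 * p / (p + 1)) ≤ 0 := by
    rw [profile_eq hp hq, threshold_sqrt hp]
    exact mul_nonpos_of_nonneg_of_nonpos (by positivity) (by linarith)
  obtain ⟨k₂, hk, hk0⟩ := intermediate_value_Icc' hq.le (continuous_profile M hp).continuousOn
    (show (0 : ℝ) ∈ Set.Icc _ _ from ⟨h1, by rw [profile_zero hp]; exact zero_le_one⟩)
  have hpos : 0 < k₂ := by
    refine hk.1.lt_of_ne fun h => ?_
    rw [← h, profile_zero hp] at hk0
    exact one_ne_zero hk0
  refine ⟨k₂, hpos, hk.2, hk0, fun k hk1 hk2 => ?_⟩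
  rcases hk1.eq_or_lt with rfl | h
  · rw [profile_zero hp]; exact one_pos
  · have h2 := strictAntiOn_threshold hp ⟨h, hk2.le.trans hk.2⟩ ⟨hpos, hk.2⟩ hk2
    rw [profile_eq hp hpos] at hk0
    have h3 := (mul_eq_zero.1 hk0).resolve_left (Real.rpow_pos_of_pos hpos _).ne'
    rw [profile_eq hp h]
    exact mul_pos (Real.rpow_pos_of_pos h _) (by linarith)

theorem tendsto_threshold_atTop {p : ℝ} (hp : 1 < p) : Tendsto (threshold p) atTop atTop := by
  have h : Tendsto (fun k : ℝ => (p + 1) / 2 * k ^ (2 / (p + 1))) atTop atTop :=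
    (tendsto_rpow_atTop (by positivity)).const_mul_atTop (by positivity)
  refine tendsto_atTop_mono' atTop ?_ h
  filter_upwards [eventually_gt_atTop 0] with k hk
  have := Real.rpow_pos_of_pos hk (-(2 * p / (p + 1)))
  simp only [threshold]
  linarith

/-- Below the critical value the profile has exactly two positive zeros. -/
theorem exists_two_zeros {p M : ℝ} (hp : 1 < p) (hM : M < -muStar 1 p) :
    ∃ k₂ k₁, 0 < k₂ ∧ k₂ < k₁ ∧ profile p M k₂ = 0 ∧ profile p M k₁ = 0 ∧
      (∀ k ∈ Set.Ioo k₂ k₁, profile p M k < 0) ∧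
      ∀ k, 0 < k → profile p M k = 0 → k = k₂ ∨ k = k₁ := by
  obtain ⟨k₂, hk₂, hle, hz₂, -⟩ := exists_first_zero hp hM.le
  set c := √(2 * p / (p + 1)) with hc
  have hq : 0 < c := by positivity
  have hval : threshold p c = muStar 1 p := threshold_sqrt hp
  have ht : ∀ k, 0 < k → profile p M k = 0 → threshold p k = -M := fun k hk h => by
    rw [profile_eq hp hk] at h
    have h3 := (mul_eq_zero.1 h).resolve_left (Real.rpow_pos_of_pos hk _).ne'
    linarith
  have hlt : k₂ < c := by
    refine hle.lt_of_ne fun h => ?_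
    have := ht k₂ hk₂ hz₂
    rw [h, hval] at this
    linarith
  obtain ⟨d, hd, hcd⟩ := ((tendsto_threshold_atTop hp).eventually_ge_atTop (-M)).and
    (eventually_ge_atTop c) |>.exists
  obtain ⟨k₁, hk₁, hz₁⟩ := intermediate_value_Icc hcd ((continuousOn_threshold hp).mono
    fun x hx => hq.trans_le hx.1) (show -M ∈ Set.Icc _ _ from ⟨by rw [hval]; linarith, hd⟩)
  have hck : c < k₁ := by
    refine hk₁.1.lt_of_ne fun h => ?_
    rw [← h, hval] at hz₁
    linarith
  have hk₁0 := hq.trans hck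
  refine ⟨k₂, k₁, hk₂, hlt.trans hck, hz₂, ?_, fun k hk => ?_, fun k hk hz => ?_⟩
  · rw [profile_eq hp hk₁0, hz₁]; ring
  · have hk0 := hk₂.trans hk.1
    rw [profile_eq hp hk0]
    refine mul_neg_of_pos_of_neg (Real.rpow_pos_of_pos hk0 _) ?_
    rcases le_total k c with h | h
    · have := strictAntiOn_threshold hp ⟨hk₂, hle⟩ ⟨hk0, h⟩ hk.1
      linarith [ht k₂ hk₂ hz₂]
    · have := strictMonoOn_threshold hp h hck.le hk.2
      linarith
  · have h1 := ht k hk hz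
    rcases le_total k c with h | h
    · exact Or.inl ((strictAntiOn_threshold hp).injOn ⟨hk, h⟩ ⟨hk₂, hle⟩
        (h1.trans (ht k₂ hk₂ hz₂).symm))
    · exact Or.inr ((strictMonoOn_threshold hp).injOn h hck.le (h1.trans hz₁.symm))

/-! ### Zeros of the profile and roots of (R) -/

theorem amplitude_pos {p k : ℝ} (hp : 1 < p) (hk : 0 < k) : 0 < amplitude p k :=
  Real.rpow_pos_of_pos (mul_pos (by linarith) hk) _

theorem amplitude_lt_amplitude {p k l : ℝ} (hp : 1 < p) (hk : 0 < k) (hkl : k < l) :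
    amplitude p l < amplitude p k := by
  have h : 0 < (p - 1) / 2 := by linarith
  refine Real.rpow_lt_rpow_of_neg (mul_pos h hk) (mul_lt_mul_of_pos_left hkl h) ?_
  have : 0 < 2 / (p - 1) := div_pos two_pos (by linarith)
  linarith

/-- After the substitution every power of `X` is `(ak)⁻²`, with `a = (p-1)/2`, times one of `1`,
`k²`, `|k|^(2p/(p+1))` up to constants, so (R) is the profile up to a positive factor. -/
theorem rootPolynomial_amplitude {p M k : ℝ} (hp : 1 < p) (hk : 0 < k) :
    amplitude p k ^ (p - 1) + M * (2 / (p - 1)) ^ (2 * p / (p + 1)) *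
      amplitude p k ^ ((p - 1) / (p + 1)) - 2 * K 1 p / (p - 1) =
      ((p - 1) / 2 * k)⁻¹ ^ 2 * profile p M k := by
  have ha : 0 < (p - 1) / 2 := by linarith
  have hp1 : p - 1 ≠ 0 := by linarith
  set a := (p - 1) / 2 with ha'
  have hak : 0 < a * k := mul_pos ha hk
  have h1 : amplitude p k ^ (p - 1) = (a * k)⁻¹ ^ 2 := by
    rw [amplitude, ← ha', ← Real.rpow_mul hak.le, ← Real.rpow_natCast, Real.inv_rpow hak.le,
      ← Real.rpow_neg hak.le]
    congr 1
    push_cast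
    field_simp
  have h2 : (2 / (p - 1)) = a⁻¹ := by rw [ha', inv_div]
  have h3 : amplitude p k ^ ((p - 1) / (p + 1)) =
      (a * k)⁻¹ ^ 2 * (a ^ (2 * p / (p + 1)) * k ^ (2 * p / (p + 1))) := by
    rw [← Real.mul_rpow ha.le hk.le, ← Real.rpow_natCast, Real.inv_rpow hak.le,
      ← Real.rpow_neg hak.le, ← Real.rpow_add hak, amplitude, ← ha', ← Real.rpow_mul hak.le]
    congr 1
    push_cast
    field_simp
    ring
  have h4 : a⁻¹ ^ (2 * p / (p + 1)) * a ^ (2 * p / (p + 1)) = 1 := by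
    rw [← Real.mul_rpow (by positivity) ha.le, inv_mul_cancel₀ ha.ne', Real.one_rpow]
  have h5 : 2 * K 1 p / (p - 1) = -((p + 1) / 2 * a⁻¹ ^ 2) := by
    rw [K, ← h2]
    push_cast
    field_simp
    ring
  rw [h1, h2, h3, h5, profile, abs_of_pos hk]
  have h6 : (a * k)⁻¹ ^ 2 * k ^ 2 = a⁻¹ ^ 2 := by
    field_simp
  linear_combination (M * (a * k)⁻¹ ^ 2 * k ^ (2 * p / (p + 1))) * h4 - (p + 1) / 2 * h6

theorem mem_positiveRoots_iff {p M X : ℝ} (hp : 1 < p) :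
    X ∈ positiveRoots 1 p M ↔ ∃ k, 0 < k ∧ profile p M k = 0 ∧ amplitude p k = X := by
  have ha : 0 < (p - 1) / 2 := by linarith
  have hne : ∀ k : ℝ, 0 < k → ((p - 1) / 2 * k)⁻¹ ^ 2 ≠ 0 := fun k hk => by positivity
  constructor
  · rintro ⟨hX, h⟩
    -- This `k` inverts the decreasing map `k ↦ ((p-1)k/2)^(-2/(p-1))`.
    have hk : 0 < X ^ (-((p - 1) / 2)) / ((p - 1) / 2) :=
      div_pos (Real.rpow_pos_of_pos hX _) ha
    have hX' : amplitude p (X ^ (-((p - 1) / 2)) / ((p - 1) / 2)) = X := by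
      rw [amplitude, mul_div_cancel₀ _ ha.ne', ← Real.rpow_mul hX.le]
      have : p - 1 ≠ 0 := by linarith
      have h2 : -((p - 1) / 2) * -(2 / (p - 1)) = 1 := by field_simp
      rw [h2, Real.rpow_one]
    refine ⟨_, hk, ?_, hX'⟩
    have h2 := rootPolynomial_amplitude (M := M) hp hk
    rw [hX', h] at h2
    exact (mul_eq_zero.1 h2.symm).resolve_left (hne _ hk)
  · rintro ⟨k, hk, hz, rfl⟩
    refine ⟨amplitude_pos hp hk, ?_⟩
    rw [rootPolynomial_amplitude hp hk, hz, mul_zero]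

theorem isGreatest_positiveRoots {p M k₂ : ℝ} (hp : 1 < p) (hk₂ : 0 < k₂)
    (hz : profile p M k₂ = 0) (hfirst : ∀ k, 0 ≤ k → k < k₂ → 0 < profile p M k) :
    IsGreatest (positiveRoots 1 p M) (amplitude p k₂) := by
  refine ⟨(mem_positiveRoots_iff hp).2 ⟨k₂, hk₂, hz, rfl⟩, fun X hX => ?_⟩
  obtain ⟨k, hk, hk0, rfl⟩ := (mem_positiveRoots_iff hp).1 hX
  rcases lt_trichotomy k k₂ with h | rfl | h
  · exact absurd hk0 (hfirst k hk.le h).ne'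
  · exact le_rfl
  · exact (amplitude_lt_amplitude hp hk₂ h).le

/-! ### From phase variables back to solutions -/

theorem contDiffOn_two_of_hasDerivAt {u w z : ℝ → ℝ} {s : Set ℝ} (hs : IsOpen s)
    (hu : ∀ r ∈ s, HasDerivAt u (w r) r) (hw : ∀ r ∈ s, HasDerivAt w (z r) r)
    (hz : ContinuousOn z s) : ContDiffOn ℝ 2 u s := by
  have h1 : ContDiffOn ℝ 1 w s := by
    rw [show (1 : WithTop ℕ∞) = 0 + 1 from rfl, contDiffOn_succ_iff_deriv_of_isOpen hs]
    refine ⟨fun r hr => (hw r hr).differentiableAt.differentiableWithinAt, by simp, ?_⟩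
    exact contDiffOn_zero.2 (hz.congr fun r hr => (hw r hr).deriv)
  rw [show (2 : WithTop ℕ∞) = 1 + 1 from rfl, contDiffOn_succ_iff_deriv_of_isOpen hs]
  exact ⟨fun r hr => (hu r hr).differentiableAt.differentiableWithinAt, by simp,
    h1.congr fun r hr => (hu r hr).deriv⟩

section Phase

variable {p M : ℝ} {φ k : ℝ → ℝ} {r : ℝ}

theorem hasDerivAt_rpow_phase (hp : 1 < p) (hφ : 0 < φ r)
    (hφ' : HasDerivAt φ ((p - 1) / 2 * k r) r) :
    HasDerivAt (fun r => φ r ^ (-(2 / (p - 1)))) (-(k r * φ r ^ (-((p + 1) / (p - 1))))) r := by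
  have hp1 : p - 1 ≠ 0 := by linarith
  refine (hφ'.rpow_const (p := -(2 / (p - 1))) (Or.inl hφ.ne')).congr_deriv ?_
  have : -(2 / (p - 1)) - 1 = -((p + 1) / (p - 1)) := by field_simp; ring
  rw [this]
  field_simp

/-- Every term of (E) scales like `φ^(-2p/(p-1))`; cancelling this factor leaves the equation for
`k`. -/
theorem hasDerivAt_slope_phase (hp : 1 < p) (hφ : 0 < φ r)
    (hφ' : HasDerivAt φ ((p - 1) / 2 * k r) r)
    (hk' : HasDerivAt k (profile p M (k r) / φ r) r) :
    HasDerivAt (fun r => -(k r * φ r ^ (-((p + 1) / (p - 1)))))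
      (-(|φ r ^ (-(2 / (p - 1)))| ^ (p - 1) * φ r ^ (-(2 / (p - 1)))) -
        M * |-(k r * φ r ^ (-((p + 1) / (p - 1))))| ^ (2 * p / (p + 1))) r := by
  have hp1 : p - 1 ≠ 0 := by linarith
  have h := (hk'.mul (hφ'.rpow_const (p := -((p + 1) / (p - 1))) (Or.inl hφ.ne'))).neg
  refine h.congr_deriv ?_
  set c := φ r
  set l := k r
  have e1 : c ^ (-((p + 1) / (p - 1))) = c ^ (-(2 * p / (p - 1))) * c := by
    nth_rw 3 [← Real.rpow_one c]
    rw [← Real.rpow_add hφ]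
    congr 1
    field_simp
    ring
  have e2 : c ^ (-((p + 1) / (p - 1)) - 1) = c ^ (-(2 * p / (p - 1))) := by
    congr 1
    field_simp
    ring
  have e3 : |c ^ (-(2 / (p - 1)))| ^ (p - 1) * c ^ (-(2 / (p - 1))) =
      c ^ (-(2 * p / (p - 1))) := by
    rw [abs_of_pos (Real.rpow_pos_of_pos hφ _), ← Real.rpow_mul hφ.le, ← Real.rpow_add hφ]
    congr 1
    field_simp
    ring
  have e4 : |-(l * c ^ (-((p + 1) / (p - 1))))| ^ (2 * p / (p + 1)) =
      |l| ^ (2 * p / (p + 1)) * c ^ (-(2 * p / (p - 1))) := by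
    rw [abs_neg, abs_mul, abs_of_pos (Real.rpow_pos_of_pos hφ _),
      Real.mul_rpow (abs_nonneg _) (Real.rpow_nonneg hφ.le _), ← Real.rpow_mul hφ.le]
    congr 2
    field_simp
  rw [e2, e3, e4, e1, profile]
  have : c ≠ 0 := hφ.ne'
  field_simp
  ring

/-- The open set is left free: `Ioi 0` serves for solutions on the half-line, and `univ` gives a
ground state its regularity through the origin. -/
theorem equation_phase (hp : 1 < p) {s : Set ℝ} (hs : IsOpen s) (hφ : ∀ r ∈ s, 0 < φ r)
    (hφ' : ∀ r ∈ s, HasDerivAt φ ((p - 1) / 2 * k r) r)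
    (hk' : ∀ r ∈ s, HasDerivAt k (profile p M (k r) / φ r) r) :
    ContDiffOn ℝ 2 (fun r => φ r ^ (-(2 / (p - 1)))) s ∧ ∀ r ∈ s,
      HasDerivAt (deriv fun r => φ r ^ (-(2 / (p - 1))))
      (-(|φ r ^ (-(2 / (p - 1)))| ^ (p - 1) * φ r ^ (-(2 / (p - 1)))) -
        M * |deriv (fun r => φ r ^ (-(2 / (p - 1)))) r| ^ (2 * p / (p + 1))) r := by
  have h1 : ∀ r ∈ s, _ := fun r hr => hasDerivAt_rpow_phase hp (hφ r hr) (hφ' r hr)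
  have h2 : ∀ r ∈ s, _ := fun r hr =>
    hasDerivAt_slope_phase (M := M) hp (hφ r hr) (hφ' r hr) (hk' r hr)
  refine ⟨contDiffOn_two_of_hasDerivAt hs h1 h2 ?_, fun r hr => ?_⟩
  · have hu : ContinuousOn (fun r => φ r ^ (-(2 / (p - 1)))) s := fun r hr =>
      (h1 r hr).continuousAt.continuousWithinAt
    have hw : ContinuousOn (fun r => -(k r * φ r ^ (-((p + 1) / (p - 1))))) s := fun r hr =>
      (h2 r hr).continuousAt.continuousWithinAt
    have hq : 0 ≤ 2 * p / (p + 1) := by positivity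
    exact ((hu.abs.rpow_const fun _ _ => Or.inr (by linarith)).mul hu).neg.sub
      (continuousOn_const.mul (hw.abs.rpow_const fun _ _ => Or.inr hq))
  · rw [(h1 r hr).deriv]
    refine (h2 r hr).congr_of_eventuallyEq ?_
    filter_upwards [hs.mem_nhds hr] with x hx using (h1 x hx).deriv

theorem isRadialSolution_phase (hp : 1 < p) (hφ : ∀ r, 0 < r → 0 < φ r)
    (hφ' : ∀ r, 0 < r → HasDerivAt φ ((p - 1) / 2 * k r) r)
    (hk' : ∀ r, 0 < r → HasDerivAt k (profile p M (k r) / φ r) r) :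
    IsRadialSolution 1 p M fun r => φ r ^ (-(2 / (p - 1))) := by
  obtain ⟨h1, h2⟩ := equation_phase hp isOpen_Ioi hφ hφ' hk'
  refine ⟨h1, fun r hr => ?_⟩
  rw [(h2 r hr).deriv]
  push_cast
  ring

theorem tendsto_rpow_phase (hp : 1 < p) {l : Filter ℝ} {c : ℝ} (hc : 0 < c)
    (h : Tendsto (fun r => φ r / r) l (𝓝 ((p - 1) / 2 * c))) :
    Tendsto (fun r => (φ r / r) ^ (-(2 / (p - 1)))) l (𝓝 (amplitude p c)) :=
  h.rpow_const (Or.inl (mul_pos (by linarith) hc).ne')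

/-- A solution with `φ(r)/r` tending to `(p-1)c/2` is asymptotic to a self-similar one. -/
theorem isEquivalent_phase (hp : 1 < p) {l : Filter ℝ} {c : ℝ} (hc : 0 < c)
    (hl : ∀ᶠ r in l, 0 < r) (hφ : ∀ r, 0 < r → 0 < φ r)
    (h : Tendsto (fun r => φ r / r) l (𝓝 ((p - 1) / 2 * c))) :
    (fun r => φ r ^ (-(2 / (p - 1)))) ~[l] selfSimilar p (amplitude p c) := by
  have hX := amplitude_pos hp hc
  rw [isEquivalent_iff_tendsto_one]
  · have h1 := (tendsto_rpow_phase hp hc h).div_const (amplitude p c)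
    rw [div_self hX.ne'] at h1
    refine h1.congr' ?_
    filter_upwards [hl] with r hr
    rw [Real.div_rpow (hφ r hr).le hr.le]
    simp only [Pi.div_apply, selfSimilar]
    rw [div_div, mul_comm]
  · filter_upwards [hl] with r hr
    exact (mul_pos hX (Real.rpow_pos_of_pos hr _)).ne'

theorem trajectory_phase (hp : 1 < p) (hφ : ∀ r, 0 < r → 0 < φ r)
    (hφ' : ∀ r, 0 < r → HasDerivAt φ ((p - 1) / 2 * k r) r) (t : ℝ) :
    trajectory p (fun r => φ r ^ (-(2 / (p - 1)))) t =
      ((φ (Real.exp t) / Real.exp t) ^ (-(2 / (p - 1))),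
        k (Real.exp t) * (φ (Real.exp t) / Real.exp t) ^ (-((p + 1) / (p - 1)))) := by
  have hr := Real.exp_pos t
  set r := Real.exp t
  rw [trajectory, (hasDerivAt_rpow_phase hp (hφ r hr) (hφ' r hr)).deriv,
    Real.div_rpow (hφ r hr).le hr.le, Real.div_rpow (hφ r hr).le hr.le,
    Real.rpow_neg hr.le, Real.rpow_neg hr.le]
  congr 1
  · rw [div_inv_eq_mul, mul_comm]
  · rw [div_inv_eq_mul]; ring

theorem tendsto_trajectory_phase (hp : 1 < p) {l : Filter ℝ} {c : ℝ} (hc : 0 < c)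
    (h : Tendsto (fun r => φ r / r) l (𝓝 ((p - 1) / 2 * c))) (hk : Tendsto k l (𝓝 c)) :
    Tendsto (fun r => ((φ r / r) ^ (-(2 / (p - 1))), k r * (φ r / r) ^ (-((p + 1) / (p - 1)))))
      l (𝓝 (equilibrium p (amplitude p c))) := by
  have hac : 0 < (p - 1) / 2 * c := mul_pos (by linarith) hc
  have hp1 : p - 1 ≠ 0 := by linarith
  have hy := hk.mul (h.rpow_const (p := -((p + 1) / (p - 1))) (Or.inl hac.ne'))
  have : c * ((p - 1) / 2 * c) ^ (-((p + 1) / (p - 1))) = 2 / (p - 1) * amplitude p c := by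
    have h1 : -((p + 1) / (p - 1)) = -(2 / (p - 1)) - 1 := by field_simp; ring
    rw [h1, Real.rpow_sub hac, Real.rpow_one, amplitude]
    field_simp
  rw [this] at hy
  exact (tendsto_rpow_phase hp hc h).prodMk_nhds hy

end Phase

/-! ### The planar system -/

/-- The trajectory of a solution is an orbit of the autonomous system. -/
theorem hasDerivAt_trajectory {p M : ℝ} {u : ℝ → ℝ} (hp : 1 < p) {t : ℝ}
    (hu : DifferentiableAt ℝ u (Real.exp t))
    (hu' : HasDerivAt (deriv u) (-(|u (Real.exp t)| ^ (p - 1) * u (Real.exp t)) -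
      M * |deriv u (Real.exp t)| ^ (2 * p / (p + 1))) (Real.exp t)) :
    HasDerivAt (trajectory p u) (vectorField 1 p M (trajectory p u t)) t := by
  have hp1 : p - 1 ≠ 0 := by linarith
  have hr := Real.exp_pos t
  have hexp := Real.hasDerivAt_exp t
  have hx := (hexp.rpow_const (p := 2 / (p - 1)) (Or.inl hr.ne')).mul
    (hu.hasDerivAt.comp t hexp)
  have hy := ((hexp.rpow_const (p := (p + 1) / (p - 1)) (Or.inl hr.ne')).mul
    (hu'.comp t hexp)).neg
  refine (hx.prodMk hy).congr_deriv ?_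
  simp only [Function.comp_apply]
  set r := Real.exp t
  set v := u r
  set w := deriv u r
  have e1 : r ^ (2 / (p - 1) - 1) * r = r ^ (2 / (p - 1)) := by
    nth_rw 2 [← Real.rpow_one r]
    rw [← Real.rpow_add hr, sub_add_cancel]
  have e2 : r ^ (2 / (p - 1)) * r = r ^ ((p + 1) / (p - 1)) := by
    nth_rw 2 [← Real.rpow_one r]
    rw [← Real.rpow_add hr]
    congr 1
    field_simp
    ring
  have e3 : r ^ ((p + 1) / (p - 1) - 1) * r = r ^ ((p + 1) / (p - 1)) := by
    nth_rw 2 [← Real.rpow_one r]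
    rw [← Real.rpow_add hr, sub_add_cancel]
  have e4 : r ^ ((p + 1) / (p - 1)) * r = r ^ (2 * p / (p - 1)) := by
    nth_rw 2 [← Real.rpow_one r]
    rw [← Real.rpow_add hr]
    congr 1
    field_simp
    ring
  have e5 : |r ^ (2 / (p - 1)) * v| ^ (p - 1) * (r ^ (2 / (p - 1)) * v) =
      r ^ (2 * p / (p - 1)) * (|v| ^ (p - 1) * v) := by
    have : r ^ (2 * p / (p - 1)) = r ^ (2 / (p - 1) * (p - 1)) * r ^ (2 / (p - 1)) := by
      rw [← Real.rpow_add hr]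
      congr 1
      field_simp
      ring
    rw [abs_mul, abs_of_pos (Real.rpow_pos_of_pos hr _),
      Real.mul_rpow (Real.rpow_nonneg hr.le _) (abs_nonneg _), ← Real.rpow_mul hr.le, this]
    ring
  have e6 : |-(r ^ ((p + 1) / (p - 1)) * w)| ^ (2 * p / (p + 1)) =
      r ^ (2 * p / (p - 1)) * |w| ^ (2 * p / (p + 1)) := by
    rw [abs_neg, abs_mul, abs_of_pos (Real.rpow_pos_of_pos hr _),
      Real.mul_rpow (Real.rpow_nonneg hr.le _) (abs_nonneg _), ← Real.rpow_mul hr.le]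
    congr 2
    field_simp
  simp only [vectorField, trajectory]
  refine Prod.ext ?_ ?_
  · change r * (2 / (p - 1)) * r ^ (2 / (p - 1) - 1) * v + r ^ (2 / (p - 1)) * (w * r) =
      2 / (p - 1) * (r ^ (2 / (p - 1)) * v) - -(r ^ ((p + 1) / (p - 1)) * w)
    linear_combination (2 / (p - 1) * v) * e1 + w * e2
  · have hK : -K 1 p = (p + 1) / (p - 1) := by
      rw [K]
      push_cast
      field_simp
      ring
    change -(r * ((p + 1) / (p - 1)) * r ^ ((p + 1) / (p - 1) - 1) * w + r ^ ((p + 1) / (p - 1)) *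
      ((-(|v| ^ (p - 1) * v) - M * |w| ^ (2 * p / (p + 1))) * r)) =
      -K 1 p * -(r ^ ((p + 1) / (p - 1)) * w) +
        |r ^ (2 / (p - 1)) * v| ^ (p - 1) * (r ^ (2 / (p - 1)) * v) +
        M * |-(r ^ ((p + 1) / (p - 1)) * w)| ^ (2 * p / (p + 1))
    rw [e5, e6, hK]
    linear_combination (-((p + 1) / (p - 1) * w)) * e3 +
      (|v| ^ (p - 1) * v + M * |w| ^ (2 * p / (p + 1))) * e4

theorem vectorField_equilibrium {p M k : ℝ} (hp : 1 < p) (hk : 0 < k)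
    (hz : profile p M k = 0) : vectorField 1 p M (equilibrium p (amplitude p k)) = 0 := by
  have hX := amplitude_pos hp hk
  have h := rootPolynomial_amplitude (M := M) hp hk
  rw [hz, mul_zero] at h
  set X := amplitude p k
  have hp1 : p - 1 ≠ 0 := by linarith
  have he : 0 < 2 / (p - 1) := div_pos two_pos (by linarith)
  have h1 : |2 / (p - 1) * X| ^ (2 * p / (p + 1)) =
      (2 / (p - 1)) ^ (2 * p / (p + 1)) * (X ^ ((p - 1) / (p + 1)) * X) := by
    rw [abs_of_pos (mul_pos he hX), Real.mul_rpow he.le hX.le]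
    nth_rw 3 [← Real.rpow_one X]
    rw [← Real.rpow_add hX]
    congr 2
    field_simp
    ring
  simp only [vectorField, equilibrium]
  refine Prod.ext (sub_self _) ?_
  change -K 1 p * (2 / (p - 1) * X) + |X| ^ (p - 1) * X +
    M * |2 / (p - 1) * X| ^ (2 * p / (p + 1)) = 0
  rw [h1, abs_of_pos hX]
  linear_combination X * h

/-! ### Construction of ground states and of the singular solution -/

/-- The exponent `2p/(p+1)` is at least `1`, so the derivative is bounded on bounded intervals.
Consequently the profile vanishes at most linearly at a zero, which a scalar orbit then cannot reach
in finite time. -/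
theorem exists_profile_lipschitz {p : ℝ} (M B : ℝ) (hp : 1 < p) :
    ∃ C, 0 < C ∧ ∀ x ∈ Set.Icc 0 B, ∀ y ∈ Set.Icc 0 B,
      profile p M y - profile p M x ≤ C * |y - x| := by
  have hq : 1 ≤ 2 * p / (p + 1) := by rw [le_div_iff₀ (by linarith)]; linarith
  set q := 2 * p / (p + 1) with hqdef
  rcases lt_or_ge B 0 with hB | hB
  · exact ⟨1, one_pos, fun x hx => absurd (hx.1.trans hx.2) hB.not_ge⟩
  refine ⟨(p + 1) * B + |M| * (q * B ^ (q - 1)) + 1, ?_, fun x hx y hy => ?_⟩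
  · have : 0 ≤ B ^ (q - 1) := Real.rpow_nonneg hB _
    positivity
  have hd : ∀ z ∈ Set.Icc 0 B, HasDerivWithinAt (fun z => 1 + (p + 1) / 2 * z ^ 2 + M * z ^ q)
      ((p + 1) * z + M * (q * z ^ (q - 1))) (Set.Icc 0 B) z := fun z _ => by
    have h1 := ((hasDerivAt_pow 2 z).const_mul ((p + 1) / 2)).const_add 1
    have h2 := (Real.hasDerivAt_rpow_const (x := z) (p := q) (Or.inr hq)).const_mul M
    refine (h1.add h2).hasDerivWithinAt.congr_deriv ?_
    push_cast
    ring
  have h := (convex_Icc 0 B).norm_image_sub_le_of_norm_hasDerivWithin_le hd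
    (C := (p + 1) * B + |M| * (q * B ^ (q - 1)) + 1) (fun z hz => by
      have h1 : z ^ (q - 1) ≤ B ^ (q - 1) := Real.rpow_le_rpow hz.1 hz.2 (by linarith)
      have h0 : 0 ≤ z ^ (q - 1) := Real.rpow_nonneg hz.1 _
      have h3 := hz.1
      have h4 := hz.2
      rw [Real.norm_eq_abs]
      refine (abs_add_le _ _).trans ?_
      rw [abs_mul M, abs_of_nonneg (show 0 ≤ q * z ^ (q - 1) by positivity),
        abs_of_nonneg (show 0 ≤ (p + 1) * z by positivity)]
      have h5 : (p + 1) * z ≤ (p + 1) * B := by gcongr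
      have h6 : |M| * (q * z ^ (q - 1)) ≤ |M| * (q * B ^ (q - 1)) := by gcongr
      linarith) hx hy
  refine (le_abs_self _).trans ?_
  simpa [profile, abs_of_nonneg hx.1, abs_of_nonneg hy.1] using h

/-- Ground states exist below the critical value. -/
theorem exists_isGroundState {p M : ℝ} (hp : 1 < p) (hM : M ≤ -muStar 1 p) :
    ∃ u, IsGroundState 1 p M u := by
  obtain ⟨k₂, hk₂, -, hz, hfirst⟩ := exists_first_zero hp hM
  obtain ⟨C, hC, hlip⟩ := exists_profile_lipschitz M k₂ hp
  have ha : 0 < (p - 1) / 2 := by linarith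
  have hbound : ∀ x ∈ Set.Ioo (-k₂) k₂, profile p M x ≤ C * (k₂ - |x|) := fun x hx => by
    have habs : |x| < k₂ := abs_lt.2 hx
    have := hlip k₂ ⟨hk₂.le, le_rfl⟩ |x| ⟨abs_nonneg x, habs.le⟩
    rwa [hz, sub_zero, profile_abs, abs_sub_comm, abs_of_pos (sub_pos.2 habs)] at this
  have hpos : ∀ x ∈ Set.Ioo (-k₂) k₂, 0 < profile p M x := fun x hx => by
    rw [← profile_abs]
    exact hfirst _ (abs_nonneg x) (abs_lt.2 hx)
  -- The profile is even, so `-k₂` is a zero as well. The symmetric interval lets the orbit start at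
  -- `0` and run in both time directions, so the solution extends across `r = 0`.
  obtain ⟨κ, hκ0, hκmem, hκd, -, -⟩ := exists_connecting_solution (f := profile p M)
    (a := -k₂) (b := k₂) (L := C) (c := 0) ⟨by linarith, hk₂⟩
    (continuous_profile M hp).continuousOn hpos hC
    (fun x hx => (hbound x hx).trans (by nlinarith [neg_abs_le x]))
    (fun x hx => (hbound x hx).trans (by nlinarith [le_abs_self x]))
  have hκc : Continuous κ := continuous_iff_continuousAt.2 fun x => (hκd x).continuousAt
  have hκm : Monotone κ := (strictMono_of_deriv_pos fun x => by
    rw [(hκd x).deriv]; exact hpos _ (hκmem x)).monotone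
  -- In the time `τ`, `φ` satisfies `dφ/dτ = (p-1)/2 · κ φ`, normalized here by `φ(0) = 1`. Since
  -- `κ` has the sign of `τ`, `Φ ≥ 1`.
  set Φ : ℝ → ℝ := fun τ => Real.exp ((p - 1) / 2 * ∫ s in (0 : ℝ)..τ, κ s) with hΦ
  have hΦd : ∀ τ, HasDerivAt Φ (Φ τ * ((p - 1) / 2 * κ τ)) τ := fun τ =>
    (((hκc.integral_hasStrictDerivAt 0 τ).hasDerivAt).const_mul ((p - 1) / 2)).exp
  have hΦc : Continuous Φ := continuous_iff_continuousAt.2 fun x => (hΦd x).continuousAt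
  have hΦ1 : ∀ τ, 1 ≤ Φ τ := fun τ => by
    refine Real.one_le_exp (mul_nonneg ha.le ?_)
    rcases le_total 0 τ with h | h
    · exact intervalIntegral.integral_nonneg h fun s hs => hκ0 ▸ hκm hs.1
    · rw [intervalIntegral.integral_symm, ← intervalIntegral.integral_neg]
      refine intervalIntegral.integral_nonneg h fun s hs => ?_
      have := hκm hs.2
      rw [hκ0] at this
      simpa using this
  -- `T` is `τ` as a function of `r`, from `dτ/dr = 1/φ`.
  obtain ⟨T, hT0, hTd, -, -, -⟩ := exists_solution_inv hΦc one_pos hΦ1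
  have hφpos : ∀ r, 0 < Φ (T r) := fun r => one_pos.trans_le (hΦ1 _)
  have hφd : ∀ r, HasDerivAt (fun r => Φ (T r)) ((p - 1) / 2 * κ (T r)) r := fun r => by
    refine ((hΦd (T r)).comp r (hTd r)).congr_deriv ?_
    have := (hφpos r).ne'
    field_simp
  have hkd : ∀ r, HasDerivAt (fun r => κ (T r)) (profile p M (κ (T r)) / Φ (T r)) r := fun r => by
    refine ((hκd (T r)).comp r (hTd r)).congr_deriv ?_
    rw [mul_one_div]
  refine ⟨fun r => Φ (T r) ^ (-(2 / (p - 1))), ?_, ?_, ?_, fun r _ =>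
    Real.rpow_pos_of_pos (hφpos r) _⟩
  · exact isRadialSolution_phase hp (fun r _ => hφpos r) (fun r _ => hφd r) fun r _ => hkd r
  · exact (equation_phase (M := M) hp isOpen_univ (fun r _ => hφpos r) (fun r _ => hφd r)
      fun r _ => hkd r).1.mono (Set.subset_univ _)
  · have h := hasDerivAt_rpow_phase (φ := fun r => Φ (T r)) (k := fun r => κ (T r)) hp
      (hφpos 0) (hφd 0)
    rw [h.hasDerivWithinAt.derivWithin (uniqueDiffOn_Ici 0 0 Set.self_mem_Ici)]
    simp [hT0, hκ0]

/-- The phase variables of the singular solution joining the two self-similar ones. -/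
theorem exists_connecting_phase {p M k₁ k₂ : ℝ} (hp : 1 < p) (hk₂ : 0 < k₂) (hk : k₂ < k₁)
    (hz₂ : profile p M k₂ = 0) (hz₁ : profile p M k₁ = 0)
    (hneg : ∀ k ∈ Set.Ioo k₂ k₁, profile p M k < 0) :
    ∃ φ k : ℝ → ℝ, (∀ r, 0 < r → 0 < φ r) ∧ (∀ r, 0 < r → 0 < k r) ∧
      (∀ r, 0 < r → HasDerivAt φ ((p - 1) / 2 * k r) r) ∧
      (∀ r, 0 < r → HasDerivAt k (profile p M (k r) / φ r) r) ∧
      Tendsto φ (𝓝[>] 0) (𝓝[>] 0) ∧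
      Tendsto k (𝓝[>] 0) (𝓝 k₁) ∧ Tendsto k atTop (𝓝 k₂) ∧
      Tendsto (fun r => φ r / r) (𝓝[>] 0) (𝓝 ((p - 1) / 2 * k₁)) ∧
      Tendsto (fun r => φ r / r) atTop (𝓝 ((p - 1) / 2 * k₂)) := by
  have ha : 0 < (p - 1) / 2 := by linarith
  set a := (p - 1) / 2
  have hk₁ := hk₂.trans hk
  obtain ⟨C, hC, hlip⟩ := exists_profile_lipschitz M k₁ hp
  have hle : ∀ x ∈ Set.Ioo k₂ k₁, ∀ A, 0 ≤ A → -profile p M x ≤ C * A →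
      -profile p M x / (a * x) ≤ C / (a * k₂) * A := fun x hx A hA h => by
    have hx0 := hk₂.trans hx.1
    calc -profile p M x / (a * x) ≤ C * A / (a * x) := by gcongr
      _ ≤ C * A / (a * k₂) := by have := hx.1; gcongr
      _ = C / (a * k₂) * A := by ring
  -- Here `φ` is the independent variable: `dk/dφ = H(k)/(a k φ)`, which is autonomous in `s = -log
  -- φ`. The minus sign makes the right-hand side positive between the zeros, so `s → ∞`, that is `φ
  -- → 0`, corresponds to `k₁`.
  obtain ⟨κ₀, -, hmem, hd, hbot, htop⟩ := exists_connecting_solution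
    (f := fun x => -profile p M x / (a * x)) (a := k₂) (b := k₁) (L := C / (a * k₂))
    (c := (k₂ + k₁) / 2) ⟨by linarith, by linarith⟩
    (by
      refine ContinuousOn.div (continuous_profile M hp).neg.continuousOn (by fun_prop) ?_
      intro x hx
      exact (mul_pos ha (hk₂.trans hx.1)).ne')
    (fun x hx => div_pos (neg_pos.2 (hneg x hx)) (mul_pos ha (hk₂.trans hx.1)))
    (by positivity)
    (fun x hx => hle x hx _ (sub_pos.2 hx.1).le (by
      have := hlip x ⟨(hk₂.trans hx.1).le, hx.2.le⟩ k₂ ⟨hk₂.le, hk.le⟩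
      rwa [hz₂, zero_sub, abs_sub_comm, abs_of_pos (sub_pos.2 hx.1)] at this))
    (fun x hx => hle x hx _ (sub_pos.2 hx.2).le (by
      have := hlip x ⟨(hk₂.trans hx.1).le, hx.2.le⟩ k₁ ⟨hk₁.le, le_rfl⟩
      rwa [hz₁, zero_sub, abs_of_pos (sub_pos.2 hx.2)] at this))
  -- The constant extension by `k₁` keeps the slope continuous at `φ = 0`, so `φ' = a κ(φ)` can be
  -- solved from `φ(0) = 0`.
  set κ : ℝ → ℝ := fun x => if x ≤ 0 then k₁ else κ₀ (-Real.log x) with hκ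
  have hκpos : ∀ x, 0 < x → κ x = κ₀ (-Real.log x) := fun x hx => if_neg hx.not_ge
  have hκ0 : κ 0 = k₁ := if_pos le_rfl
  have hκd : ∀ x, 0 < x → HasDerivAt κ (profile p M (κ x) / (a * κ x) / x) x := fun x hx => by
    have h := (hd (-Real.log x)).comp x (Real.hasDerivAt_log hx.ne').neg
    rw [hκpos x hx]
    refine (h.congr_deriv ?_).congr_of_eventuallyEq ?_
    · rw [div_eq_mul_inv _ x]; ring
    · filter_upwards [lt_mem_nhds hx] with y hy using hκpos y hy
  have hκright : Tendsto κ (𝓝[>] 0) (𝓝 k₁) := by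
    have h := htop.comp (tendsto_neg_atBot_atTop.comp Real.tendsto_log_nhdsGT_zero)
    refine h.congr' ?_
    filter_upwards [self_mem_nhdsWithin] with x hx using (hκpos x hx).symm
  have hκc : Continuous κ := by
    refine continuous_iff_continuousAt.2 fun x => ?_
    rcases lt_trichotomy x 0 with h | rfl | h
    · refine continuousAt_const.congr (f := fun _ => k₁) ?_
      filter_upwards [gt_mem_nhds h] with y hy using (if_pos hy.le).symm
    · rw [continuousAt_iff_continuous_left'_right']
      constructor
      · refine (continuousWithinAt_const (b := k₁)).congr (fun y hy => ?_) hκ0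
        exact if_pos (le_of_lt hy)
      · rw [ContinuousWithinAt, hκ0]; exact hκright
    · exact (hκd x h).continuousAt
  have hκI : ∀ x, κ x ∈ Set.Icc k₂ k₁ := fun x => by
    rcases le_or_gt x 0 with h | h
    · rw [hκ]; simp only [if_pos h]; exact ⟨hk.le, le_rfl⟩
    · rw [hκpos x h]; exact Set.Ioo_subset_Icc_self (hmem _)
  have hκ_pos : ∀ x, 0 < κ x := fun x => hk₂.trans_le (hκI x).1
  obtain ⟨T, hT0, hTd, hTm, hTtop, -⟩ := exists_solution_inv
    (f := fun x => 1 / (a * κ x))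
    (continuous_const.div (continuous_const.mul hκc) fun x => (mul_pos ha (hκ_pos x)).ne')
    (c := 1 / (a * k₁)) (by positivity) (fun x => by
      have := (hκI x).2
      have := hκ_pos x
      gcongr)
  simp only [one_div_one_div] at hTd
  have hTpos : ∀ r, 0 < r → 0 < T r := fun r hr => hT0 ▸ hTm hr
  have hTc : Continuous T := continuous_iff_continuousAt.2 fun x => (hTd x).continuousAt
  have hT0' : Tendsto T (𝓝[>] 0) (𝓝[>] 0) := by
    refine tendsto_nhdsWithin_iff.2 ⟨?_, ?_⟩
    · have := hTc.tendsto 0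
      rw [hT0] at this
      exact this.mono_left nhdsWithin_le_nhds
    · filter_upwards [self_mem_nhdsWithin] with r hr using hTpos r hr
  have hktop : Tendsto (fun r => κ (T r)) atTop (𝓝 k₂) := by
    have h := hbot.comp (tendsto_neg_atTop_atBot.comp (Real.tendsto_log_atTop.comp hTtop))
    refine h.congr' ?_
    filter_upwards [eventually_gt_atTop 0] with r hr using (hκpos _ (hTpos r hr)).symm
  refine ⟨T, fun r => κ (T r), hTpos, fun r _ => hκ_pos _, fun r _ => hTd r, fun r hr => ?_,
    hT0', hκright.comp hT0', hktop, ?_, ?_⟩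
  · refine ((hκd _ (hTpos r hr)).comp r (hTd r)).congr_deriv ?_
    have h1 := (hκ_pos (T r)).ne'
    have h2 := (hTpos r hr).ne'
    field_simp
  -- As `φ(0) = 0`, the quotient `φ/r` is the difference quotient at `0`, with limit `φ'(0) = a k₁`.
  · have h := hasDerivAt_iff_tendsto_slope.1 (hTd 0)
    rw [hT0, hκ0] at h
    refine (h.mono_left (nhdsWithin_mono 0 fun x hx => ne_of_gt hx)).congr fun r => ?_
    rw [slope_def_field, hT0, sub_zero, sub_zero]
  · exact tendsto_div_id_of_tendsto_deriv (Eventually.of_forall hTd) (hktop.const_mul a)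

/-- Below the critical value there is a positive singular solution whose trajectory is a
heteroclinic orbit. -/
theorem exists_singular_solution {p M : ℝ} (hp : 1 < p) (hM : M < -muStar 1 p) :
    ∃ X₁ X₂ : ℝ, X₁ < X₂ ∧ positiveRoots 1 p M = {X₁, X₂} ∧
      ∃ u : ℝ → ℝ, IsPositiveSingularSolution 1 p M u ∧
        u ~[𝓝[>] 0] selfSimilar p X₁ ∧ u ~[atTop] selfSimilar p X₂ ∧
        (∀ t : ℝ, 0 < (trajectory p u t).1 ∧ 0 < (trajectory p u t).2) ∧
        IsHeteroclinicOrbit (vectorField 1 p M) (trajectory p u)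
          (equilibrium p X₁) (equilibrium p X₂) := by
  obtain ⟨k₂, k₁, hk₂, hk, hz₂, hz₁, hneg, huniq⟩ := exists_two_zeros hp hM
  have hk₁ := hk₂.trans hk
  have hX := amplitude_lt_amplitude hp hk₂ hk
  have he : 0 < 2 / (p - 1) := div_pos two_pos (by linarith)
  obtain ⟨φ, k, hφ, hkpos, hφd, hkd, hφ0, hk0, hktop, hr0, hrtop⟩ :=
    exists_connecting_phase hp hk₂ hk hz₂ hz₁ hneg
  refine ⟨amplitude p k₁, amplitude p k₂, hX, ?_, fun r => φ r ^ (-(2 / (p - 1))),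
    ⟨isRadialSolution_phase hp hφ hφd hkd, fun r hr => Real.rpow_pos_of_pos (hφ r hr) _, ?_⟩,
    isEquivalent_phase hp hk₁ self_mem_nhdsWithin hφ hr0,
    isEquivalent_phase hp hk₂ (eventually_gt_atTop 0) hφ hrtop, fun t => ?_, ?_⟩
  · ext X
    rw [mem_positiveRoots_iff hp]
    constructor
    · rintro ⟨l, hl, hl0, rfl⟩
      rcases huniq l hl hl0 with rfl | rfl <;> simp
    · rintro (rfl | rfl)
      exacts [⟨k₁, hk₁, hz₁, rfl⟩, ⟨k₂, hk₂, hz₂, rfl⟩]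
  · exact (tendsto_rpow_neg_nhdsGT_zero (by linarith)).comp hφ0
  · rw [trajectory_phase hp hφ hφd]
    have hr := Real.exp_pos t
    have h := div_pos (hφ _ hr) hr
    exact ⟨Real.rpow_pos_of_pos h _, mul_pos (hkpos _ hr) (Real.rpow_pos_of_pos h _)⟩
  · obtain ⟨-, heq⟩ := equation_phase hp isOpen_Ioi hφ hφd hkd
    refine ⟨fun t => hasDerivAt_trajectory hp ?_ (heq _ (Real.exp_pos t)),
      vectorField_equilibrium hp hk₁ hz₁, vectorField_equilibrium hp hk₂ hz₂,
      fun h => hX.ne (congrArg Prod.fst h), ?_, ?_⟩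
    · exact (hasDerivAt_rpow_phase hp (hφ _ (Real.exp_pos t))
        (hφd _ (Real.exp_pos t))).differentiableAt
    · rw [funext fun t => trajectory_phase hp hφ hφd t]
      exact (tendsto_trajectory_phase hp hk₁ hr0 hk0).comp Real.tendsto_exp_atBot_nhdsGT
    · rw [funext fun t => trajectory_phase hp hφ hφd t]
      exact (tendsto_trajectory_phase hp hk₂ hrtop hktop).comp Real.tendsto_exp_atTop

/-! ### Phase analysis of an arbitrary ground state -/

/-- The phase variables of a ground state: `φ = u^(-(p-1)/2)` and `k = -u' u^(-(p+1)/2)`. -/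
structure IsGroundPhase (p M : ℝ) (φ k : ℝ → ℝ) : Prop where
  pos : ∀ r, 0 ≤ r → 0 < φ r
  zero : k 0 = 0
  deriv_fst : ∀ r, 0 ≤ r → HasDerivWithinAt φ ((p - 1) / 2 * k r) (Set.Ici 0) r
  deriv_snd : ∀ r, 0 ≤ r → HasDerivWithinAt k (profile p M (k r) / φ r) (Set.Ici 0) r

theorem IsGroundState.exists_isGroundPhase {p M : ℝ} {u : ℝ → ℝ} (hp : 1 < p)
    (h : IsGroundState 1 p M u) :
    ∃ φ k, IsGroundPhase p M φ k ∧ ∀ r, 0 ≤ r → u r = φ r ^ (-(2 / (p - 1))) := by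
  have hp1 : p - 1 ≠ 0 := by linarith
  have hU := uniqueDiffOn_Ici (0 : ℝ)
  set u₁ := derivWithin u (Set.Ici 0) with hu₁
  have hC1 : ContDiffOn ℝ 1 u₁ (Set.Ici 0) := by
    have := h.contDiffOn_Ici
    rw [show (2 : WithTop ℕ∞) = 1 + 1 from rfl, contDiffOn_succ_iff_derivWithin hU] at this
    exact this.2.2
  have hd0 : ∀ r, 0 ≤ r → HasDerivWithinAt u (u₁ r) (Set.Ici 0) r := fun r hr =>
    (h.contDiffOn_Ici.differentiableOn (by norm_num) r hr).hasDerivWithinAt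
  have hd1 : ∀ r, 0 ≤ r → HasDerivWithinAt u₁ (derivWithin u₁ (Set.Ici 0) r) (Set.Ici 0) r :=
    fun r hr => (hC1.differentiableOn (by norm_num) r hr).hasDerivWithinAt
  have hint : ∀ r : ℝ, 0 < r → deriv u r = u₁ r := fun r hr =>
    (derivWithin_of_mem_nhds (Ici_mem_nhds hr)).symm
  have hq : 0 ≤ 2 * p / (p + 1) := by positivity
  -- The equation is given only for `r > 0`; continuity of both sides carries it to `r = 0`, where
  -- the phase system needs a one-sided derivative.
  have heq : Set.EqOn (derivWithin u₁ (Set.Ici 0))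
      (fun r => -(|u r| ^ (p - 1) * u r) - M * |u₁ r| ^ (2 * p / (p + 1))) (Set.Ici 0) := by
    refine Set.EqOn.of_subset_closure (s := Set.Ioi 0) (fun r hr => ?_)
      (hC1.continuousOn_derivWithin hU le_rfl) ?_ Set.Ioi_subset_Ici_self (by rw [closure_Ioi])
    · have h1 := h.isRadialSolution.equation r hr
      have h2 : deriv (deriv u) r = derivWithin u₁ (Set.Ici 0) r := by
        rw [derivWithin_of_mem_nhds (Ici_mem_nhds hr)]
        refine EventuallyEq.deriv_eq ?_
        filter_upwards [lt_mem_nhds hr] with x hx using hint x hx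
      rw [h2, hint r hr] at h1
      push_cast at h1
      simp only [sub_self, zero_div, zero_mul, sub_zero] at h1
      linarith
    · have hu := h.contDiffOn_Ici.continuousOn
      exact ((hu.abs.rpow_const fun _ _ => Or.inr (by linarith)).mul hu).neg.sub
        (continuousOn_const.mul (hC1.continuousOn.abs.rpow_const fun _ _ => Or.inr hq))
  refine ⟨fun r => u r ^ (-((p - 1) / 2)), fun r => -u₁ r * u r ^ (-((p + 1) / 2)),
    ⟨fun r hr => Real.rpow_pos_of_pos (h.pos r hr) _, ?_, fun r hr => ?_, fun r hr => ?_⟩,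
    fun r hr => ?_⟩
  · simp only [hu₁, h.derivWithin_zero]; simp
  · refine ((hd0 r hr).rpow_const (Or.inl (h.pos r hr).ne')).congr_deriv ?_
    have : -((p - 1) / 2) - 1 = -((p + 1) / 2) := by ring
    rw [this]
    ring
  · have hpos := h.pos r hr
    refine ((hd1 r hr).neg.mul ((hd0 r hr).rpow_const (p := -((p + 1) / 2))
      (Or.inl hpos.ne'))).congr_deriv ?_
    rw [heq hr, profile]
    set v := u r
    set w := u₁ r
    have e1 : |v| ^ (p - 1) * v = v ^ p := by
      nth_rw 2 [← Real.rpow_one v]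
      rw [abs_of_pos hpos, ← Real.rpow_add hpos, sub_add_cancel]
    have e2 : |-w * v ^ (-((p + 1) / 2))| ^ (2 * p / (p + 1)) =
        |w| ^ (2 * p / (p + 1)) * v ^ (-p) := by
      rw [abs_mul, abs_neg, abs_of_pos (Real.rpow_pos_of_pos hpos _),
        Real.mul_rpow (abs_nonneg _) (Real.rpow_nonneg hpos.le _), ← Real.rpow_mul hpos.le]
      congr 2
      field_simp
    have e3 : v ^ p * v ^ (-((p + 1) / 2)) = v ^ ((p - 1) / 2) := by
      rw [← Real.rpow_add hpos]; congr 1; ring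
    have e4 : v ^ (-p) * v ^ ((p - 1) / 2) = v ^ (-((p + 1) / 2)) := by
      rw [← Real.rpow_add hpos]; congr 1; ring
    have e5 : (v ^ (-((p + 1) / 2))) ^ 2 * v ^ ((p - 1) / 2) = v ^ (-((p + 1) / 2) - 1) := by
      rw [← Real.rpow_natCast, ← Real.rpow_mul hpos.le, ← Real.rpow_add hpos]
      congr 1
      push_cast
      ring
    simp only [Pi.neg_apply]
    rw [e1, e2, Real.rpow_neg hpos.le ((p - 1) / 2), div_inv_eq_mul]
    linear_combination e3 - M * |w| ^ (2 * p / (p + 1)) * e4 - (p + 1) / 2 * w ^ 2 * e5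
  · have hpos := h.pos r hr
    rw [← Real.rpow_mul hpos.le]
    have : -((p - 1) / 2) * -(2 / (p - 1)) = 1 := by field_simp
    rw [this, Real.rpow_one]

namespace IsGroundPhase

variable {p M : ℝ} {φ k : ℝ → ℝ}

theorem hasDerivAt_fst (h : IsGroundPhase p M φ k) {r : ℝ} (hr : 0 < r) :
    HasDerivAt φ ((p - 1) / 2 * k r) r :=
  (h.deriv_fst r hr.le).hasDerivAt (Ici_mem_nhds hr)

theorem hasDerivAt_snd (h : IsGroundPhase p M φ k) {r : ℝ} (hr : 0 < r) :
    HasDerivAt k (profile p M (k r) / φ r) r :=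
  (h.deriv_snd r hr.le).hasDerivAt (Ici_mem_nhds hr)

theorem continuousOn_fst (h : IsGroundPhase p M φ k) : ContinuousOn φ (Set.Ici 0) :=
  fun r hr => (h.deriv_fst r hr).continuousWithinAt

theorem continuousOn_snd (h : IsGroundPhase p M φ k) : ContinuousOn k (Set.Ici 0) :=
  fun r hr => (h.deriv_snd r hr).continuousWithinAt

/-- At a contact with `0` the slope variable has derivative `1/φ > 0`, so it cannot cross downwards.
-/
theorem nonneg (h : IsGroundPhase p M φ k) (hp : 1 < p) {r : ℝ} (hr : 0 ≤ r) : 0 ≤ k r := by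
  have := image_le_of_deriv_right_lt_deriv_boundary' (f := fun x => -k x)
    (f' := fun x => -(profile p M (k x) / φ x)) (a := 0) (b := r) (B := fun _ => 0)
    (B' := fun _ => 0) (h.continuousOn_snd.mono Set.Icc_subset_Ici_self).neg
    (fun x hx => ((h.deriv_snd x hx.1).mono (Set.Ici_subset_Ici.2 hx.1)).neg)
    (by simp [h.zero]) continuousOn_const (fun x _ => hasDerivWithinAt_const _ _ _)
    (fun x hx hx0 => by
      rw [neg_eq_zero.1 hx0, profile_zero hp]
      exact neg_lt_zero.2 (div_pos one_pos (h.pos x hx.1))) ⟨hr, le_rfl⟩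
  simpa using this

theorem monotoneOn_fst (h : IsGroundPhase p M φ k) (hp : 1 < p) :
    MonotoneOn φ (Set.Ici 0) := by
  refine monotoneOn_of_deriv_nonneg (convex_Ici 0) h.continuousOn_fst ?_ ?_ <;>
    rw [interior_Ici]
  · exact fun r hr => (h.hasDerivAt_fst hr).differentiableAt.differentiableWithinAt
  · intro r hr
    rw [(h.hasDerivAt_fst hr).deriv]
    exact mul_nonneg (by linarith) (h.nonneg hp (le_of_lt hr))

theorem monotoneOn_snd (h : IsGroundPhase p M φ k)
    (hH : ∀ r, 0 < r → 0 ≤ profile p M (k r)) : MonotoneOn k (Set.Ici 0) := by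
  refine monotoneOn_of_deriv_nonneg (convex_Ici 0) h.continuousOn_snd ?_ ?_ <;>
    rw [interior_Ici]
  · exact fun r hr => (h.hasDerivAt_snd hr).differentiableAt.differentiableWithinAt
  · intro r hr
    rw [(h.hasDerivAt_snd hr).deriv]
    exact div_nonneg (hH r hr) (h.pos r (le_of_lt hr)).le

/-- A bounded slope variable converges to a zero of the profile. -/
theorem exists_tendsto (h : IsGroundPhase p M φ k) (hp : 1 < p) {B : ℝ}
    (hB : ∀ r, 0 ≤ r → k r ≤ B) (hH : ∀ x ∈ Set.Icc 0 B, 0 ≤ profile p M x) :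
    ∃ l ∈ Set.Icc 0 B, profile p M l = 0 ∧ Tendsto k atTop (𝓝 l) := by
  have hmem : ∀ r, 0 ≤ r → k r ∈ Set.Icc 0 B := fun r hr => ⟨h.nonneg hp hr, hB r hr⟩
  have hmono := h.monotoneOn_snd fun r hr => hH _ (hmem r hr.le)
  obtain ⟨l, hl⟩ : ∃ l, Tendsto k atTop (𝓝 l) := by
    have hm : Monotone fun r => k (max r 0) := fun r s hrs =>
      hmono (le_max_right r 0) (le_max_right s 0) (max_le_max_right 0 hrs)
    have hbdd : BddAbove (Set.range fun r => k (max r 0)) :=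
      ⟨B, by rintro _ ⟨r, rfl⟩; exact hB _ (le_max_right r 0)⟩
    refine ⟨_, (tendsto_atTop_ciSup hm hbdd).congr' ?_⟩
    filter_upwards [eventually_ge_atTop 0] with r hr
    rw [max_eq_left hr]
  have hlmem : l ∈ Set.Icc 0 B := isClosed_Icc.mem_of_tendsto hl
    ((eventually_ge_atTop 0).mono hmem)
  refine ⟨l, hlmem, ?_, hl⟩
  by_contra hne
  have hpos : 0 < profile p M l := (hH l hlmem).lt_of_ne (Ne.symm hne)
  set δ := profile p M l / 2 with hδ
  have hδ0 : 0 < δ := by positivity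
  set D := (p - 1) / 2 * l + 1 with hD
  have hD0 : 0 < D := by
    have : 0 ≤ (p - 1) / 2 * l := mul_nonneg (by linarith) hlmem.1
    linarith
  have hφ := tendsto_div_id_of_tendsto_deriv
    ((eventually_gt_atTop 0).mono fun r hr => h.hasDerivAt_fst hr) (hl.const_mul ((p - 1) / 2))
  obtain ⟨R, hR⟩ := eventually_atTop.1 ((eventually_gt_atTop (0 : ℝ)).and
    ((hφ.eventually_le_const (u := D) (by linarith)).and
    ((((continuous_profile M hp).tendsto l).comp hl).eventually_const_le (u := δ)
      (by linarith))))
  -- If `H(l) > 0`, then eventually `H(k) ≥ δ` while `φ ≤ D r`, so `k' ≥ δ/(D r)` and `k` grows at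
  -- least like a logarithm, against the bound `B`.
  have hmono2 : MonotoneOn (fun r => k r - δ / D * Real.log r) (Set.Ici R) := by
    have hd : ∀ r ∈ Set.Ici R, HasDerivAt (fun r => k r - δ / D * Real.log r)
        (profile p M (k r) / φ r - δ / D * r⁻¹) r := fun r hr =>
      (h.hasDerivAt_snd (hR r hr).1).sub
        ((Real.hasDerivAt_log (hR r hr).1.ne').const_mul (δ / D))
    refine monotoneOn_of_deriv_nonneg (convex_Ici R)
      (fun r hr => (hd r hr).continuousAt.continuousWithinAt) (fun r hr =>
      (hd r (interior_subset hr)).differentiableAt.differentiableWithinAt) fun r hr => ?_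
    have hr' := interior_subset hr
    obtain ⟨h0, h1, h2⟩ := hR r hr'
    rw [(hd r hr').deriv, sub_nonneg]
    have h3 := h.pos r h0.le
    rw [div_le_iff₀ h0] at h1
    simp only [Function.comp_apply] at h2
    calc δ / D * r⁻¹ = δ / (D * r) := by field_simp
      _ ≤ profile p M (k r) / φ r := div_le_div₀ (hδ0.le.trans h2) h2 h3 h1
  have htop : Tendsto (fun r => k R - δ / D * Real.log R + δ / D * Real.log r) atTop atTop :=
    tendsto_atTop_add_const_left _ _ (Real.tendsto_log_atTop.const_mul_atTop (by positivity))
  obtain ⟨r, hr1, hr2⟩ := ((htop.eventually_gt_atTop B).and (eventually_ge_atTop R)).exists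
  have h1 := hmono2 Set.self_mem_Ici hr2 hr2
  have h2 := hB r (hR r hr2).1.le
  simp only at h1
  linarith

/-- The slope variable stays below the first zero of the profile. -/
theorem le_first_zero (h : IsGroundPhase p M φ k) (hp : 1 < p) {k₂ : ℝ} (hk₂ : 0 < k₂)
    (hz : profile p M k₂ = 0) {r : ℝ} (hr : 0 ≤ r) : k r ≤ k₂ := by
  obtain ⟨C, hC, hlip⟩ := exists_profile_lipschitz M k₂ hp
  have hφ0 := h.pos 0 le_rfl
  -- The barrier is `k₂(1 - e^(-Ax))`. At a contact, `k' ≤ C(k₂ - k)/φ ≤ (C/φ(0))(k₂ - k)` because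
  -- `φ` is nondecreasing; the extra `1` makes the comparison with `A(k₂ - k)` strict.
  set A := C / φ 0 + 1 with hA
  have hA0 : 0 < A := by positivity
  have hd : ∀ x, HasDerivAt (fun x => k₂ * (1 - Real.exp (-A * x)))
      (k₂ * (A * Real.exp (-A * x))) x := fun x => by
    have := ((((hasDerivAt_id x).const_mul (-A)).exp).const_sub 1).const_mul k₂
    refine this.congr_deriv ?_
    simp only [id]
    ring
  have := image_le_of_deriv_right_lt_deriv_boundary (f := k)
    (f' := fun x => profile p M (k x) / φ x) (a := 0) (b := r)
    (h.continuousOn_snd.mono Set.Icc_subset_Ici_self)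
    (fun x hx => (h.deriv_snd x hx.1).mono (Set.Ici_subset_Ici.2 hx.1))
    (by simp [h.zero]) hd
    (fun x hx hx0 => by
      have he := Real.exp_pos (-A * x)
      have hφx := h.monotoneOn_fst hp Set.self_mem_Ici hx.1 hx.1
      have hle : k x ≤ k₂ := by rw [hx0]; nlinarith
      have h1 := hlip k₂ ⟨hk₂.le, le_rfl⟩ (k x) ⟨h.nonneg hp hx.1, hle⟩
      rw [hz, sub_zero, abs_sub_comm, abs_of_nonneg (sub_nonneg.2 hle)] at h1
      have h2 : k₂ - k x = k₂ * Real.exp (-A * x) := by rw [hx0]; ring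
      rw [h2] at h1
      calc profile p M (k x) / φ x ≤ C * (k₂ * Real.exp (-A * x)) / φ x := by
            have := h.pos x hx.1
            gcongr
        _ ≤ C * (k₂ * Real.exp (-A * x)) / φ 0 := by gcongr
        _ = C / φ 0 * (k₂ * Real.exp (-A * x)) := by ring
        _ < A * (k₂ * Real.exp (-A * x)) := by
            have : C / φ 0 < A := by linarith
            gcongr
        _ = k₂ * (A * Real.exp (-A * x)) := by ring) ⟨hr, le_rfl⟩
  refine this.trans ?_
  nlinarith [Real.exp_pos (-A * r)]

end IsGroundPhase

/-! ### Nonexistence above the critical value, and conclusion -/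

/-- The exponent `2p/(p+1)` is below `2`, so the spare `k²/2` absorbs the term in `M`. The constant
`p/2` is the one that makes `-u' u^(-1/2)` monotone. -/
theorem eventually_le_profile {p : ℝ} (M : ℝ) (hp : 1 < p) :
    ∀ᶠ x in atTop, p / 2 * x ^ 2 ≤ profile p M x := by
  have h := tendsto_rpow_atTop (y := 2 / (p + 1)) (by positivity)
  filter_upwards [eventually_gt_atTop 0, h.eventually_ge_atTop (2 * |M|)] with x hx hx2
  have h2 : x ^ (2 * p / (p + 1)) * x ^ (2 / (p + 1)) = x ^ 2 := by
    rw [← Real.rpow_add hx, ← Real.rpow_natCast]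
    congr 1
    push_cast
    field_simp
  have h3 := Real.rpow_pos_of_pos hx (2 * p / (p + 1))
  rw [profile, abs_of_pos hx]
  nlinarith [neg_abs_le M]

/-- No global solution when the profile has no zero. -/
theorem IsGroundPhase.false_of_profile_pos {p M : ℝ} {φ k : ℝ → ℝ} (h : IsGroundPhase p M φ k)
    (hp : 1 < p) (hH : ∀ x, 0 < profile p M x) : False := by
  have hp1 : 0 < p - 1 := by linarith
  have hmono := h.monotoneOn_snd fun r _ => (hH (k r)).le
  obtain ⟨B, hB⟩ := eventually_atTop.1 ((eventually_le_profile M hp).and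
    (eventually_gt_atTop 0))
  obtain ⟨R, hR, hRB⟩ : ∃ R, 0 ≤ R ∧ B < k R := by
    by_contra! hcon
    obtain ⟨l, -, hl, -⟩ := h.exists_tendsto hp hcon fun x _ => (hH x).le
    exact (hH l).ne' hl
  obtain ⟨S, hRS⟩ := exists_gt R
  have hpos : ∀ r ∈ Set.Ici S, 0 < r := fun r hr => (hR.trans_lt hRS).trans_le hr
  have hk : ∀ r ∈ Set.Ici S, B ≤ k r := fun r hr =>
    hRB.le.trans (hmono hR (hpos r hr).le (hRS.le.trans hr))
  -- This function is `-u' u^(-1/2)`; it is nondecreasing once `H(k) ≥ (p/2) k²`.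
  have hYd : ∀ r ∈ Set.Ici S, HasDerivAt (fun r => k r * φ r ^ (-(p / (p - 1))))
      (φ r ^ (-(p / (p - 1)) - 1) * (profile p M (k r) - p / 2 * k r ^ 2)) r := fun r hr => by
    have hφ := h.pos r (hpos r hr).le
    refine ((h.hasDerivAt_snd (hpos r hr)).mul ((h.hasDerivAt_fst (hpos r hr)).rpow_const
      (p := -(p / (p - 1))) (Or.inl hφ.ne'))).congr_deriv ?_
    rw [Real.rpow_sub hφ, Real.rpow_one]
    field_simp
    ring
  have hY : MonotoneOn (fun r => k r * φ r ^ (-(p / (p - 1)))) (Set.Ici S) := by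
    refine monotoneOn_of_deriv_nonneg (convex_Ici S)
      (fun r hr => (hYd r hr).continuousAt.continuousWithinAt) (fun r hr =>
      (hYd r (interior_subset hr)).differentiableAt.differentiableWithinAt) fun r hr => ?_
    have hr' := interior_subset hr
    rw [(hYd r hr').deriv]
    exact mul_nonneg (Real.rpow_nonneg (h.pos r (hpos r hr').le).le _)
      (sub_nonneg.2 (hB _ (hk r hr')).1)
  set Y := k S * φ S ^ (-(p / (p - 1))) with hYdef
  have hY0 : 0 < Y := mul_pos (hB _ (hk S Set.self_mem_Ici)).2
    (Real.rpow_pos_of_pos (h.pos S (hpos S Set.self_mem_Ici).le) _)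
  -- Here `φ^(-1/(p-1))` is `√u`, whose derivative is at most `-Y/2`: a positive function cannot
  -- decrease at a linear rate forever.
  have hZd : ∀ r ∈ Set.Ici S, HasDerivAt (fun r => φ r ^ (-(1 / (p - 1))) + Y / 2 * r)
      (-(k r * φ r ^ (-(p / (p - 1)))) / 2 + Y / 2) r := fun r hr => by
    have hφ := h.pos r (hpos r hr).le
    refine (((h.hasDerivAt_fst (hpos r hr)).rpow_const
      (p := -(1 / (p - 1))) (Or.inl hφ.ne')).add
      ((hasDerivAt_id r).const_mul (Y / 2))).congr_deriv ?_
    have : -(1 / (p - 1)) - 1 = -(p / (p - 1)) := by field_simp; ring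
    rw [this]
    field_simp
  have hZ : AntitoneOn (fun r => φ r ^ (-(1 / (p - 1))) + Y / 2 * r) (Set.Ici S) := by
    refine antitoneOn_of_deriv_nonpos (convex_Ici S)
      (fun r hr => (hZd r hr).continuousAt.continuousWithinAt) (fun r hr =>
      (hZd r (interior_subset hr)).differentiableAt.differentiableWithinAt) fun r hr => ?_
    have hr' := interior_subset hr
    rw [(hZd r hr').deriv]
    have := hY Set.self_mem_Ici hr' hr'
    simp only at this
    linarith
  obtain ⟨r, hr1, hr2⟩ := (((tendsto_id.const_mul_atTop (half_pos hY0)).eventually_gt_atTop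
    (φ S ^ (-(1 / (p - 1))) + Y / 2 * S)).and (eventually_ge_atTop S)).exists
  have h1 := hZ Set.self_mem_Ici hr2 hr2
  have h2 := Real.rpow_pos_of_pos (h.pos r (hpos r hr2).le) (-(1 / (p - 1)))
  simp only [id] at h1 hr1
  linarith

theorem IsGroundState.le_neg_muStar {p M : ℝ} {u : ℝ → ℝ} (h : IsGroundState 1 p M u)
    (hp : 1 < p) : M ≤ -muStar 1 p := by
  by_contra! hM
  obtain ⟨φ, k, hφ, -⟩ := h.exists_isGroundPhase hp
  exact hφ.false_of_profile_pos hp (profile_pos hp hM)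

/-- Every ground state is asymptotic to the self-similar solution with the greatest amplitude. -/
theorem IsGroundState.isEquivalent_selfSimilar {p M : ℝ} {u : ℝ → ℝ}
    (h : IsGroundState 1 p M u) (hp : 1 < p) :
    ∃ X₂ : ℝ, IsGreatest (positiveRoots 1 p M) X₂ ∧ u ~[atTop] selfSimilar p X₂ := by
  obtain ⟨k₂, hk₂, -, hz, hfirst⟩ := exists_first_zero hp (h.le_neg_muStar hp)
  obtain ⟨φ, k, hφ, hu⟩ := h.exists_isGroundPhase hp
  obtain ⟨l, hl, hl0, hlim⟩ := hφ.exists_tendsto hp (fun r hr => hφ.le_first_zero hp hk₂ hz hr)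
    fun x hx => by
      rcases hx.2.eq_or_lt with rfl | hlt
      exacts [hz.ge, (hfirst x hx.1 hlt).le]
  obtain rfl : l = k₂ := hl.2.eq_of_not_lt fun hlt => (hfirst l hl.1 hlt).ne' hl0
  refine ⟨amplitude p l, isGreatest_positiveRoots hp hk₂ hz hfirst, ?_⟩
  have h1 := isEquivalent_phase hp hk₂ (eventually_gt_atTop 0) (fun r hr => hφ.pos r hr.le)
    (tendsto_div_id_of_tendsto_deriv
      ((eventually_gt_atTop 0).mono fun r hr => hφ.hasDerivAt_fst hr)
      (hlim.const_mul ((p - 1) / 2)))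
  refine h1.congr_left ?_
  filter_upwards [eventually_ge_atTop 0] with r hr using (hu r hr).symm

end RadialGrad

theorem mainTheorem8 (p M : ℝ) (hp : 1 < p) :
    ((∃ u : ℝ → ℝ, RadialGrad.IsGroundState 1 p M u) ↔ M ≤ -RadialGrad.muStar 1 p) ∧
    (∀ u : ℝ → ℝ, RadialGrad.IsGroundState 1 p M u →
      ∃ X₂ : ℝ, IsGreatest (RadialGrad.positiveRoots 1 p M) X₂ ∧
        u ~[atTop] RadialGrad.selfSimilar p X₂) ∧
    (M < -RadialGrad.muStar 1 p →
      ∃ X₁ X₂ : ℝ, X₁ < X₂ ∧ RadialGrad.positiveRoots 1 p M = {X₁, X₂} ∧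
        ∃ u : ℝ → ℝ, RadialGrad.IsPositiveSingularSolution 1 p M u ∧
          u ~[𝓝[>] 0] RadialGrad.selfSimilar p X₁ ∧
          u ~[atTop] RadialGrad.selfSimilar p X₂ ∧
          (∀ t : ℝ, 0 < (RadialGrad.trajectory p u t).1 ∧
            0 < (RadialGrad.trajectory p u t).2) ∧
          RadialGrad.IsHeteroclinicOrbit (RadialGrad.vectorField 1 p M)
            (RadialGrad.trajectory p u)
            (RadialGrad.equilibrium p X₁) (RadialGrad.equilibrium p X₂)) :=
  ⟨⟨fun ⟨_, hu⟩ => hu.le_neg_muStar hp, RadialGrad.exists_isGroundState hp⟩,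
    fun _ hu => hu.isEquivalent_selfSimilar hp, RadialGrad.exists_singular_solution hp⟩
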